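/- **Setting.** Let $N,d\ge 0$ be integers and $H\in(1/4,1)$. Let $B=(B^1,\dots,B^d)$ be a $d$-dimensional fractional Brownian motion on $[0,1]$ with Hurst parameter $H$, i.e. a continuous centered Gaussian process with $$\mathbb E[B^i_sB^j_t]=\tfrac12\left(s^{2H}+t^{2H}-|s-t|^{2H}\right)\delta_{ij}.$$ Let $\mathcal C_1$ be the closed linear span in $L^2(\mathbb P)$ of all $B^i_t$ ($0\le t\le1$, $1\le i\le d$). The Cameron–Martin space $\bar{\mathcal H}$ consists of all continuous paths $h:[0,1]\to\mathbb R^d$ with $h_0=0$ of the form $h_t=\mathbb E[B_tZ]$ with $Z\in\mathcal C_1$; such a $Z$ is unique, and $\langle h_1,h_2\rangle_{\bar{\mathcal H}}=\mathbb E[Z_1Z_2]$. Let $V_1,\dots,V_d$ be $C_b^\infty$ vector fields on $\mathbb R^N$ (smooth, and bounded together with all their derivatives), and let $V(x)$ be the $N\times d$ matrix with columns $V_\alpha(x)$. A path $h\in\bar{\mathcal H}$ is said to join $x$ to $y$ if the differential equation $$dx_t=\sum_{\alpha=1}^dV_\alpha(x_t)\,dh^\alpha_t,\qquad x_0=x,\qquad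 0\le t\le 1,$$ has a solution with $x_1=y$, where the equation is understood in the sense of Young: for some $1\le q<2$ both $h$ and the continuous path $(x_t)$ have finite $q$-variation, and $x_t-x=\sum_\alpha\int_0^tV_\alpha(x_s)\,dh_s^\alpha$ for all $t\in[0,1]$ as limits of Riemann–Stieltjes sums. Let $\Pi_{x,y}$ be the set of such $h$ and define the control distance $$d_H(x,y)=\inf\{\|h\|_{\bar{\mathcal H}}:h\in\Pi_{x,y}\}\in[0,\infty],\qquad \inf\emptyset=\infty .$$ **Theorem 3.3.** Assume that the vector fields are uniformly elliptic: there are constants $\Lambda_1,\Lambda_2>0$ such that $$\Lambda_1|\xi|^2\le\xi^*V(x)V(x)^*\xi\le\Lambda_2|\xi|^2\qquad\text{for all }x,\xi\in\mathbb R^N.$$ Then there exist constants $C_1,C_2>0$, depending only on $H$ and the vector fields, such that $$C_1|x-y|\le d_H(x,y)\le C_2|x-y|$$ for all $x,y\in\mathbb R^N$ with $|x-y|\le1$. In particular, $\Pi_{x,y}\neq\emptyset$ for such $x,y$. -/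

import Mathlib

open MeasureTheory ProbabilityTheory Set
open scoped unitInterval Matrix ENNReal

namespace FBM

noncomputable section

/-- The covariance function of (scalar) fractional Brownian motion with Hurst parameter `H`. -/
def cov (H s t : ℝ) : ℝ :=
  (1 / 2) * (s ^ (2 * H) + t ^ (2 * H) - |s - t| ^ (2 * H))

/-- `B` is, under `P`, a `d`-dimensional fractional Brownian motion on `[0, 1]` with Hurst
parameter `H`: a continuous centered Gaussian process with `E[B_s^i B_t^j] = R(s, t) δ_{ij}`. -/
structure IsFractionalBrownianMotion {Ω : Type*} [MeasurableSpace Ω] (P : Measure Ω) (H : ℝ)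
    {d : ℕ} (B : I → Ω → EuclideanSpace ℝ (Fin d)) : Prop where
  gaussian : IsGaussianProcess B P
  continuous_paths : ∀ᵐ ω ∂P, Continuous fun t => B t ω
  centered : ∀ (t : I) (i : Fin d), ∫ ω, B t ω i ∂P = 0
  covariance : ∀ (s t : I) (i j : Fin d),
    ∫ ω, B s ω i * B t ω j ∂P = if i = j then cov H s t else 0

section CameronMartin

variable {Ω : Type*} [MeasurableSpace Ω] (P : Measure Ω) {d : ℕ}
  (B : I → Ω → EuclideanSpace ℝ (Fin d))

/-- The first order Wiener chaos: the closed linear span in `L²(P)` of the random variables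
`B_t^i`. -/
def firstChaos : Submodule ℝ (Lp ℝ 2 P) :=
  (Submodule.span ℝ
    {W : Lp ℝ 2 P | ∃ (t : I) (i : Fin d), W =ᵐ[P] fun ω => B t ω i}).topologicalClosure

/-- The path `h` is given by `h_t = E[B_t Z]`, for an element `Z` of the first chaos. -/
def Represents (Z : Lp ℝ 2 P) (h : C(I, EuclideanSpace ℝ (Fin d))) : Prop :=
  Z ∈ firstChaos P B ∧ ∀ (t : I) (i : Fin d), h t i = ∫ ω, B t ω i * Z ω ∂P

/-- The Cameron--Martin subspace of `B`: all continuous paths `h_t = E[B_t Z]` with `Z` in the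
first chaos. -/
def cameronMartin : Set C(I, EuclideanSpace ℝ (Fin d)) :=
  {h | h 0 = 0 ∧ ∃ Z : Lp ℝ 2 P, Represents P B Z h}

open Classical in
/-- The element `Z` of the first chaos such that `h_t = E[B_t Z]` (`0` if there is none). -/
def chaosOf (h : C(I, EuclideanSpace ℝ (Fin d))) : Lp ℝ 2 P :=
  if hZ : ∃ Z : Lp ℝ 2 P, Represents P B Z h then hZ.choose else 0

/-- The Cameron--Martin inner product `⟨h₁, h₂⟩ = E[Z₁ Z₂]`. -/
def cmInner (h₁ h₂ : C(I, EuclideanSpace ℝ (Fin d))) : ℝ :=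
  ∫ ω, chaosOf P B h₁ ω * chaosOf P B h₂ ω ∂P

/-- The Cameron--Martin norm. -/
def cmNorm (h : C(I, EuclideanSpace ℝ (Fin d))) : ℝ :=
  Real.sqrt (cmInner P B h h)

variable {P B}

/-- The random variable representing a Cameron--Martin path is unique. -/
theorem Represents.unique {Z₁ Z₂ : Lp ℝ 2 P} {h : C(I, EuclideanSpace ℝ (Fin d))}
    (h₁ : Represents P B Z₁ h) (h₂ : Represents P B Z₂ h) : Z₁ = Z₂ := by
  have key : ∀ W ∈ firstChaos P B, inner ℝ W (Z₁ - Z₂) = 0 := by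
    intro W hW
    have hle : firstChaos P B ≤ (Submodule.span ℝ {Z₁ - Z₂})ᗮ := by
      refine Submodule.topologicalClosure_minimal _ (Submodule.span_le.2 ?_)
        (Submodule.isClosed_orthogonal _)
      rintro W ⟨t, i, hWt⟩
      refine Submodule.mem_orthogonal_singleton_iff_inner_left.2 ?_
      have aux : ∀ Z : Lp ℝ 2 P, inner ℝ W Z = ∫ ω, B t ω i * Z ω ∂P := by
        intro Z
        rw [L2.inner_def]
        refine integral_congr_ae ?_
        filter_upwards [hWt] with ω hω
        simp [hω, mul_comm]
      rw [inner_sub_right, aux, aux, ← h₁.2, ← h₂.2, sub_self]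
    exact Submodule.mem_orthogonal_singleton_iff_inner_left.1 (hle hW)
  exact sub_eq_zero.1 (inner_self_eq_zero.1 (key _ (Submodule.sub_mem _ h₁.1 h₂.1)))

theorem Represents.chaosOf_eq {Z : Lp ℝ 2 P} {h : C(I, EuclideanSpace ℝ (Fin d))}
    (hZ : Represents P B Z h) : chaosOf P B h = Z := by
  have hex : ∃ Z : Lp ℝ 2 P, Represents P B Z h := ⟨Z, hZ⟩
  unfold chaosOf
  rw [dif_pos hex]
  exact hex.choose_spec.unique hZ

/-- The Cameron--Martin norm of `h_t = E[B_t Z]` is the `L²` norm of `Z`. -/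
theorem Represents.cmNorm_eq {Z : Lp ℝ 2 P} {h : C(I, EuclideanSpace ℝ (Fin d))}
    (hZ : Represents P B Z h) : cmNorm P B h = ‖Z‖ := by
  have h1 : inner ℝ Z Z = ∫ ω, Z ω * Z ω ∂P := by
    rw [L2.inner_def]
    simp [← pow_two]
  unfold cmNorm cmInner
  rw [hZ.chaosOf_eq, ← h1, real_inner_self_eq_norm_sq, Real.sqrt_sq (norm_nonneg _)]

end CameronMartin

/-- The path `f` on `[0, 1]` has finite `q`-variation: the sums `∑ |f(u_{i+1}) - f(u_i)|^q` over
all finite increasing sequences are bounded. -/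
def HasFiniteVariation {E : Type*} [NormedAddCommGroup E] (q : ℝ) (f : I → E) : Prop :=
  ∃ M : ℝ, ∀ (n : ℕ) (u : ℕ → I), Monotone u →
    ∑ i ∈ Finset.range n, ‖f (u (i + 1)) - f (u i)‖ ^ q ≤ M

section ControlDistance

variable {N d : ℕ} (V : Fin d → EuclideanSpace ℝ (Fin N) → EuclideanSpace ℝ (Fin N))

/-- `L` is the Young integral `∫_0^t ∑_α V_α(X_s) dh_s^α`: the limit of all tagged
Riemann--Stieltjes sums over partitions of `[0, t]` as the mesh tends to `0`. -/
def HasYoungIntegral (X : I → EuclideanSpace ℝ (Fin N)) (h : I → EuclideanSpace ℝ (Fin d))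
    (t : I) (L : EuclideanSpace ℝ (Fin N)) : Prop :=
  ∀ ε > 0, ∃ δ > 0, ∀ (n : ℕ) (u τ : ℕ → I), Monotone u → u 0 = 0 → u n = t →
    (∀ i < n, (u (i + 1) : ℝ) - u i ≤ δ) →
    (∀ i < n, τ i ∈ Icc (u i) (u (i + 1))) →
    ‖(∑ i ∈ Finset.range n, ∑ α : Fin d,
        (h (u (i + 1)) α - h (u i) α) • V α (X (τ i))) - L‖ ≤ ε

/-- `X` solves `dX_t = ∑_α V_α(X_t) dh_t^α`, `X_0 = x`, on `[0, 1]` in the sense of Young: for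
some `1 ≤ q < 2` both `h` and `X` are continuous of finite `q`-variation, and the integral equation
holds with Young integrals. -/
def IsYoungSolution (h : C(I, EuclideanSpace ℝ (Fin d))) (x : EuclideanSpace ℝ (Fin N))
    (X : C(I, EuclideanSpace ℝ (Fin N))) : Prop :=
  (∃ q : ℝ, 1 ≤ q ∧ q < 2 ∧ HasFiniteVariation q h ∧ HasFiniteVariation q X) ∧
    ∀ t : I, HasYoungIntegral V X h t (X t - x)

/-- The Cameron--Martin paths `h` that join `x` to `y` in the sense of differential equations:
the solution started at `x` and driven by `h` is at `y` at time `1`. -/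
def joiningPaths {Ω : Type*} [MeasurableSpace Ω] (P : Measure Ω)
    (B : I → Ω → EuclideanSpace ℝ (Fin d)) (x y : EuclideanSpace ℝ (Fin N)) :
    Set C(I, EuclideanSpace ℝ (Fin d)) :=
  {h | h ∈ cameronMartin P B ∧ ∃ X, IsYoungSolution V h x X ∧ X 1 = y}

/-- The control distance: the infimum of the Cameron--Martin norms of the paths joining `x` to
`y` (with the convention `inf ∅ = ∞`). -/
def controlDist {Ω : Type*} [MeasurableSpace Ω] (P : Measure Ω)
    (B : I → Ω → EuclideanSpace ℝ (Fin d)) (x y : EuclideanSpace ℝ (Fin N)) : ℝ≥0∞ :=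
  ⨅ h ∈ joiningPaths V P B x y, ENNReal.ofReal (cmNorm P B h)

/-- The vector fields are of class `C_b^∞`: smooth, and bounded with all their derivatives. -/
def IsCbInfty : Prop :=
  ∀ α, ContDiff ℝ (⊤ : ℕ∞) (V α) ∧ ∀ n : ℕ, ∃ M : ℝ, ∀ x, ‖iteratedFDeriv ℝ n (V α) x‖ ≤ M

/-- The `N × d` matrix `V(x)` whose columns are the vectors `V_α(x)`. -/
def fieldMatrix (x : EuclideanSpace ℝ (Fin N)) : Matrix (Fin N) (Fin d) ℝ :=
  Matrix.of fun i α => V α x i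

/-- Uniform ellipticity: `Λ₁ |ξ|² ≤ ξ* V(x) V(x)* ξ ≤ Λ₂ |ξ|²` for all `x` and `ξ`. -/
def IsUniformlyElliptic : Prop :=
  ∃ Λ₁ > 0, ∃ Λ₂ > 0, ∀ x ξ : EuclideanSpace ℝ (Fin N),
    Λ₁ * ‖ξ‖ ^ 2 ≤ ξ.ofLp ⬝ᵥ (fieldMatrix V x * (fieldMatrix V x)ᵀ) *ᵥ ξ.ofLp ∧
    ξ.ofLp ⬝ᵥ (fieldMatrix V x * (fieldMatrix V x)ᵀ) *ᵥ ξ.ofLp ≤ Λ₂ * ‖ξ‖ ^ 2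

end ControlDistance

end

end FBM

/-!
The lower bound rests on the regularity of Cameron--Martin paths. Such a path is `h_t = E[B_t Z]`.
If `H ≤ 1/2`, the increments of `B` over disjoint intervals are negatively correlated, so their Gram
matrix is at most twice its diagonal (`norm_sum_smul_sq_le`); testing `Z` against the right
combination of increments gives `∑ |h_{u_k, u_{k+1}}|² / |u_{k+1} - u_k|^{2H} ≤ 2 ‖Z‖²` for each
coordinate and every partition (`sum_sq_div_le`). If `H > 1/2`, the Cauchy--Schwarz inequality gives
Hölder regularity of exponent `H`. In both cases `|h_t - h_s| ≤ C ‖Z‖ ω(s, t)^γ` with a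
superadditive `ω`, bounded by a dimensional constant, and some `γ > 1/2` (`exists_isControl`).

A Young solution `X` is then compared with its Euler increments `V(X_s) (h_t - h_s)`. For
`s ≤ u ≤ t`, the defect of additivity of `X_t - X_s - V(X_s) (h_t - h_s)` is at most a constant
times `|X_u - X_s| |h_t - h_u|`, and a discrete sewing argument on a fine partition (`norm_le_of_discrete_sewing`) bounds
`|X_1 - X_0|` by a multiple of `‖Z‖` as long as `‖Z‖` is small
(`IsYoungSolution.norm_sub_le`). If `‖Z‖` is not small, the bound is trivial, because
`|x - y| ≤ 1`. The unknown `q`-variation of `X` only serves to make the Euler errors along a fine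
partition negligible (`exists_partition_sum_le`), so it does not enter the constants.

For the upper bound, the segment `x + φ(t) (y - x)`, with `φ` a smooth bump, solves the equation
driven by `h` with `h' = V* (V V*)⁻¹ (y - x) φ'`, evaluated along the segment. The path `h` depends
on `t` only through `φ(t)`; so it vanishes outside `[0, 2]`, and it is bounded, with its first two
derivatives, by a multiple of `|x - y|`. That `h` lies in the Cameron--Martin space comes from the spectral
representation of the covariance, `E[B_s B_t] = ⟪e_s, e_t⟫` in `L²(ℝ, ℂ)` with
`e_t(ξ) = κ (e^{2πitξ} - 1) |ξ|^{-H-1/2}` (`inner_spectralVec`). Fourier inversion writes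
`h_t = ⟪e_t, w⟫`, where the norm of `w` is controlled by the decay of the Fourier transform of `h`
(`exists_spectral_representer`), and `w` is transferred to the first chaos because the two families
have the same Gram matrix (`exists_representer_of_gram_eq`).
-/

namespace FBM

/-! ### Superadditive controls and discrete sewing -/

/-- The supremum of the sums `∑ Φ(u_i, u_{i+1})` over finite increasing sequences in `[s, t]`. The
sequences are indexed by `ℕ`, and only finitely many of their terms enter the sum. -/
noncomputable def supControl (Φ : I → I → ℝ) (s t : I) : ℝ :=
  sSup {r | ∃ (n : ℕ) (u : ℕ → I), Monotone u ∧ (∀ i, u i ∈ Icc s t) ∧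
    r = ∑ i ∈ Finset.range n, Φ (u i) (u (i + 1))}

/-- The sums of `Φ` over all finite increasing sequences in `[0, 1]` are at most `M`. -/
def PartitionSumsLE (Φ : I → I → ℝ) (M : ℝ) : Prop :=
  ∀ (n : ℕ) (u : ℕ → I), Monotone u → ∑ i ∈ Finset.range n, Φ (u i) (u (i + 1)) ≤ M

/-- A nonnegative function of pairs of times, superadditive over adjacent intervals. -/
structure IsControl (ω : I → I → ℝ) : Prop where
  nonneg : ∀ s t, s ≤ t → 0 ≤ ω s t
  superadd : ∀ s m t, s ≤ m → m ≤ t → ω s m + ω m t ≤ ω s t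

namespace PartitionSumsLE

variable {Φ : I → I → ℝ} {M : ℝ}

theorem bddAbove (hM : PartitionSumsLE Φ M) (s t : I) :
    BddAbove {r | ∃ (n : ℕ) (u : ℕ → I), Monotone u ∧ (∀ i, u i ∈ Icc s t) ∧
      r = ∑ i ∈ Finset.range n, Φ (u i) (u (i + 1))} := by
  refine ⟨M, ?_⟩
  rintro _ ⟨n, u, hu, -, rfl⟩
  exact hM n u hu

theorem sum_le_supControl (hM : PartitionSumsLE Φ M) {s t : I} (n : ℕ) {u : ℕ → I}
    (hu : Monotone u) (hst : ∀ i, u i ∈ Icc s t) :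
    ∑ i ∈ Finset.range n, Φ (u i) (u (i + 1)) ≤ supControl Φ s t :=
  le_csSup (hM.bddAbove s t) ⟨n, u, hu, hst, rfl⟩

end PartitionSumsLE

theorem supControl_le {Φ : I → I → ℝ} {s t : I} (hst : s ≤ t) {M : ℝ}
    (h : ∀ (n : ℕ) (u : ℕ → I), Monotone u → (∀ i, u i ∈ Icc s t) →
      ∑ i ∈ Finset.range n, Φ (u i) (u (i + 1)) ≤ M) :
    supControl Φ s t ≤ M := by
  refine csSup_le ⟨0, 0, fun _ => s, monotone_const, fun _ => ⟨le_rfl, hst⟩, by simp⟩ ?_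
  rintro _ ⟨n, u, hu, hus, rfl⟩
  exact h n u hu hus

namespace PartitionSumsLE

variable {Φ : I → I → ℝ} {M : ℝ}

theorem supControl_le (hM : PartitionSumsLE Φ M) {s t : I} (hst : s ≤ t) :
    supControl Φ s t ≤ M :=
  FBM.supControl_le hst fun n u hu _ => hM n u hu

theorem le_supControl (hM : PartitionSumsLE Φ M) {s t : I} (hst : s ≤ t) :
    Φ s t ≤ supControl Φ s t := by
  have h := hM.sum_le_supControl (s := s) (t := t) 1 (u := fun i => if i = 0 then s else t)
    (monotone_nat_of_le_succ fun i => by by_cases hi : i = 0 <;> simp [hi, hst])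
    (fun i => by by_cases hi : i = 0 <;> simp [hi, hst])
  simpa using h

theorem supControl_nonneg (hM : PartitionSumsLE Φ M) {s t : I} (hst : s ≤ t) :
    0 ≤ supControl Φ s t := by
  simpa using hM.sum_le_supControl (s := s) (t := t) 0 (u := fun _ => s) monotone_const
    (fun _ => ⟨le_rfl, hst⟩)

theorem isControl (hM : PartitionSumsLE Φ M) (hΦ : ∀ s t, s ≤ t → 0 ≤ Φ s t) :
    IsControl (supControl Φ) where
  nonneg _ _ := hM.supControl_nonneg
  superadd s m t hsm hmt := by
    -- Increasing sequences in `[s, m]` and in `[m, t]` are concatenated; the jump from one to the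
    -- other contributes a nonnegative term.
    rw [← le_sub_iff_add_le]
    refine FBM.supControl_le hsm fun n u hu hus => ?_
    rw [le_sub_comm]
    refine FBM.supControl_le hmt fun n' v hv hvs => ?_
    rw [le_sub_iff_add_le']
    set w : ℕ → I := fun i => if i ≤ n then u i else v (i - (n + 1)) with hw
    have hwmono : Monotone w := by
      refine monotone_nat_of_le_succ fun i => ?_
      simp only [hw]
      split_ifs with h1 h2 h2
      · exact hu (by omega)
      · exact (hus i).2.trans (hvs _).1
      · omega
      · exact hv (by omega)
    have hwmem : ∀ i, w i ∈ Icc s t := by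
      intro i
      simp only [hw]
      split_ifs
      · exact ⟨(hus i).1, (hus i).2.trans hmt⟩
      · exact ⟨hsm.trans (hvs _).1, (hvs _).2⟩
    refine le_trans ?_ (hM.sum_le_supControl (n + 1 + n') hwmono hwmem)
    rw [Finset.sum_range_add, Finset.sum_range_succ]
    have e1 : ∑ i ∈ Finset.range n, Φ (w i) (w (i + 1))
        = ∑ i ∈ Finset.range n, Φ (u i) (u (i + 1)) := by
      refine Finset.sum_congr rfl fun i hi => ?_
      have := Finset.mem_range.1 hi
      simp only [hw]
      rw [if_pos (by omega), if_pos (by omega)]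
    have e2 : ∑ i ∈ Finset.range n', Φ (w (n + 1 + i)) (w (n + 1 + i + 1))
        = ∑ i ∈ Finset.range n', Φ (v i) (v (i + 1)) := by
      refine Finset.sum_congr rfl fun i _ => ?_
      simp only [hw]
      rw [if_neg (by omega), if_neg (by omega)]
      congr 2 <;> omega
    rw [e1, e2]
    have := hΦ (w n) (w (n + 1)) (hwmono (by omega))
    linarith

end PartitionSumsLE

theorem IsControl.sum_le {ω : I → I → ℝ} (hω : IsControl ω) {u : ℕ → I} (hu : Monotone u)
    (n : ℕ) : ∑ i ∈ Finset.range n, ω (u i) (u (i + 1)) ≤ ω (u 0) (u n) := by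
  induction n with
  | zero => simpa using hω.nonneg _ _ le_rfl
  | succ n ih =>
    rw [Finset.sum_range_succ]
    have := hω.superadd (u 0) (u n) (u (n + 1)) (hu (by omega)) (hu (by omega))
    linarith

theorem IsControl.mono {ω : I → I → ℝ} (hω : IsControl ω) {s s' t' t : I} (h₁ : s ≤ s')
    (h₂ : s' ≤ t') (h₃ : t' ≤ t) : ω s' t' ≤ ω s t := by
  have a := hω.superadd s s' t h₁ (h₂.trans h₃)
  have b := hω.superadd s' t' t h₂ h₃
  have c := hω.nonneg s s' h₁
  have d := hω.nonneg t' t h₃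
  linarith

theorem IsControl.add {ω ω' : I → I → ℝ} (hω : IsControl ω) (hω' : IsControl ω') :
    IsControl fun s t => ω s t + ω' s t where
  nonneg s t hst := add_nonneg (hω.nonneg s t hst) (hω'.nonneg s t hst)
  superadd s m t h₁ h₂ := by
    have a := hω.superadd s m t h₁ h₂
    have b := hω'.superadd s m t h₁ h₂
    linarith

theorem isControl_sub : IsControl fun s t : I => (t : ℝ) - s where
  nonneg _ _ hst := sub_nonneg.2 hst
  superadd _ _ _ _ _ := by linarith

/-- The gap `1/2 - 2^{-2γ}` in the sewing argument, positive exactly when `2γ > 1`. -/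
noncomputable def sewingGap (γ : ℝ) : ℝ := 1 / 2 - (1 / 2 : ℝ) ^ (2 * γ)

theorem sewingGap_pos {γ : ℝ} (hγ : 1 / 2 < γ) : 0 < sewingGap γ := by
  have : (1 / 2 : ℝ) ^ (2 * γ) < (1 / 2 : ℝ) ^ (1 : ℝ) :=
    Real.rpow_lt_rpow_of_exponent_gt (by norm_num) (by norm_num) (by linarith)
  rw [Real.rpow_one] at this
  unfold sewingGap
  linarith

/-- The arithmetic of one splitting step: the two main errors, both with the factor `θ²`, and the
two defects add up to at most the error allowed on the whole interval. -/
theorem sewing_step {A a b x κ θ r₁ r r₂ e : ℝ} (hA : 0 ≤ A) (hb : 0 ≤ b) (hx : 0 ≤ x)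
    (hκ : 0 < κ) (hκ2 : κ ≤ 1 / 2) (hθ : 0 < θ) (hθκ : θ ^ 2 = 1 / 2 - κ)
    (hθ34 : θ * (1 + κ) ≤ 3 / 4) (hAa : A * κ = 2 * a) (hr₁ : 0 ≤ r₁) (hr : 0 ≤ r) (hr₂ : 0 ≤ r₂)
    (hbx : b * x ≤ κ) (he : e ≤ A * (θ ^ 2 * x ^ 2) + (1 + 4 * b * (θ * x)) * r₁) :
    e + r + (A * (θ ^ 2 * x ^ 2) + (1 + 4 * b * (θ * x)) * r₂) + (a * x + b * e) * x
      + (a * x + b * r) * x ≤ A * x ^ 2 + (1 + 4 * b * x) * (r₁ + r + r₂) := by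
  have hy0 : 0 ≤ b * x := mul_nonneg hb hx
  have hfeed : e * (1 + b * x) ≤
      (A * (θ ^ 2 * x ^ 2) + (1 + 4 * b * (θ * x)) * r₁) * (1 + b * x) :=
    mul_le_mul_of_nonneg_right he (by positivity)
  have hAx : 0 ≤ A * x ^ 2 := by positivity
  have c1 : A * (θ ^ 2 * x ^ 2) * (1 + b * x) + A * (θ ^ 2 * x ^ 2) + 2 * a * x ^ 2
      ≤ A * x ^ 2 := by
    have e : A * (θ ^ 2 * x ^ 2) * (1 + b * x) + A * (θ ^ 2 * x ^ 2) + 2 * a * x ^ 2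
        = A * x ^ 2 * (1 - κ + (b * x) * (1 / 2 - κ)) := by
      rw [hθκ, ← hAa]; ring
    rw [e]
    refine mul_le_of_le_one_right hAx ?_
    have h1 : b * x * (1 / 2 - κ) ≤ κ * (1 / 2 - κ) :=
      mul_le_mul_of_nonneg_right hbx (by linarith)
    have h2 : 0 ≤ κ * κ := by positivity
    linarith
  have c2 : (1 + 4 * b * (θ * x)) * r₁ * (1 + b * x) ≤ (1 + 4 * b * x) * r₁ := by
    have : (1 + 4 * b * (θ * x)) * (1 + b * x) ≤ 1 + 4 * b * x := by
      have h1 : θ * (1 + b * x) ≤ 3 / 4 :=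
        (mul_le_mul_of_nonneg_left (by linarith) hθ.le).trans hθ34
      have h2 := mul_le_mul_of_nonneg_left h1 hy0
      linarith
    calc _ = (1 + 4 * b * (θ * x)) * (1 + b * x) * r₁ := by ring
      _ ≤ _ := mul_le_mul_of_nonneg_right this hr₁
  have c3 : (1 + 4 * b * (θ * x)) * r₂ ≤ (1 + 4 * b * x) * r₂ := by
    refine mul_le_mul_of_nonneg_right ?_ hr₂
    have h1 : θ ≤ 1 := by nlinarith
    have h2 := mul_le_mul_of_nonneg_left h1 hy0
    linarith
  have c4 : 0 ≤ b * x * r := mul_nonneg hy0 hr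
  linarith

/-- Discrete sewing with a feedback term. The sequence is split where the control is halved, so
that the main error is summed as a geometric series of ratio `2^{1 - 2γ} < 1`. The feedback
`b ‖E i k‖`, as well as the elementary errors `ρ`, are absorbed because `b ω(u_0, u_n)^γ` is
small. -/
theorem norm_le_of_discrete_sewing {F : Type*} [SeminormedAddCommGroup F] {ω : I → I → ℝ}
    (hω : IsControl ω) {u : ℕ → I} (hu : Monotone u) {n : ℕ} {γ a b : ℝ} (hγ : 1 / 2 < γ)
    (ha : 0 ≤ a) (hb : 0 ≤ b) {E : ℕ → ℕ → F} {ρ : ℕ → ℝ} (hρ : ∀ i, 0 ≤ ρ i)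
    (hsmall : b * ω (u 0) (u n) ^ γ ≤ sewingGap γ) (hE0 : ∀ i, E i i = 0)
    (hE1 : ∀ l < n, ‖E l (l + 1)‖ ≤ ρ l)
    (hδ : ∀ i k j, i ≤ k → k ≤ j → j ≤ n → ‖E i j - E i k - E k j‖ ≤
      (a * ω (u i) (u k) ^ γ + b * ‖E i k‖) * ω (u k) (u j) ^ γ)
    {i j : ℕ} (hij : i ≤ j) (hjn : j ≤ n) :
    ‖E i j‖ ≤ 2 * a / sewingGap γ * (ω (u i) (u j) ^ γ) ^ 2 + 3 * ∑ l ∈ Finset.Ico i j, ρ l := by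
  set κ := sewingGap γ with hκdef
  have hκ : 0 < κ := sewingGap_pos hγ
  set θ : ℝ := (1 / 2 : ℝ) ^ γ with hθdef
  have hθ0 : 0 < θ := by positivity
  have hθκ : θ ^ 2 = 1 / 2 - κ := by
    rw [hκdef, sewingGap, hθdef, ← Real.rpow_natCast, ← Real.rpow_mul (by norm_num)]
    norm_num [mul_comm]
  have hθ34 : θ * (1 + κ) ≤ 3 / 4 := by
    refine abs_le_of_sq_le_sq' ?_ (by norm_num) |>.2
    have : (θ * (1 + κ)) ^ 2 = (1 / 2 - κ) * (1 + κ) ^ 2 := by rw [mul_pow, hθκ]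
    rw [this]
    nlinarith [sq_nonneg κ, mul_pos hκ hκ]
  have hκ2 : κ ≤ 1 / 2 := by nlinarith [sq_nonneg θ]
  set A := 2 * a / κ with hA
  have hA0 : 0 ≤ A := by positivity
  have hAa : A * κ = 2 * a := by rw [hA]; field_simp
  -- the elementary errors carry a factor that grows with the control, to make the induction close
  suffices H : ∀ m i j, i ≤ j → j ≤ n → j - i = m → ‖E i j‖ ≤
      A * (ω (u i) (u j) ^ γ) ^ 2
        + (1 + 4 * b * ω (u i) (u j) ^ γ) * ∑ l ∈ Finset.Ico i j, ρ l by
    refine (H _ i j hij hjn rfl).trans ?_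
    have h1 : b * ω (u i) (u j) ^ γ ≤ κ :=
      le_trans (mul_le_mul_of_nonneg_left (Real.rpow_le_rpow (hω.nonneg _ _ (hu hij))
        (hω.mono (hu (Nat.zero_le i)) (hu hij) (hu hjn)) (by linarith)) hb) hsmall
    have h2 : 0 ≤ ∑ l ∈ Finset.Ico i j, ρ l := Finset.sum_nonneg fun l _ => hρ l
    have h3 : (1 + 4 * b * ω (u i) (u j) ^ γ) * ∑ l ∈ Finset.Ico i j, ρ l
        ≤ 3 * ∑ l ∈ Finset.Ico i j, ρ l := mul_le_mul_of_nonneg_right (by linarith) h2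
    linarith
  intro m
  induction m using Nat.strong_induction_on with
  | _ m ih =>
  intro i j hij hjn hm
  rcases hij.eq_or_lt with rfl | hlt
  · rw [hE0, norm_zero]
    have := hω.nonneg (u i) (u i) le_rfl
    simp only [Finset.Ico_self, Finset.sum_empty, mul_zero, add_zero]
    positivity
  have hzero : ∀ s, ω s s = 0 := fun s =>
    le_antisymm (by have := hω.superadd s s s le_rfl le_rfl; linarith) (hω.nonneg _ _ le_rfl)
  have hW : 0 ≤ ω (u i) (u j) := hω.nonneg _ _ (hu hij)
  -- the last index `k < j` at which at most half of the control has been used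
  obtain ⟨k, hik, hkj, hk1, hk2⟩ : ∃ k, i ≤ k ∧ k < j ∧ ω (u i) (u k) ≤ ω (u i) (u j) / 2 ∧
      ω (u (k + 1)) (u j) ≤ ω (u i) (u j) / 2 := by
    classical
    let S := (Finset.Ico i j).filter fun k => ω (u i) (u k) ≤ ω (u i) (u j) / 2
    have hS : S.Nonempty := ⟨i, by
      simp only [S, Finset.mem_filter, Finset.mem_Ico, le_refl, true_and]
      exact ⟨hlt, by rw [hzero]; linarith⟩⟩
    have hmem := S.max'_mem hS
    set k := S.max' hS with hkdef
    simp only [S, Finset.mem_filter, Finset.mem_Ico] at hmem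
    refine ⟨k, hmem.1.1, hmem.1.2, hmem.2, ?_⟩
    rcases (Nat.succ_le_of_lt hmem.1.2).eq_or_lt with h | h
    · rw [Nat.succ_eq_add_one] at h
      rw [h, hzero]; linarith
    · by_contra hcon
      have hle : ω (u i) (u (k + 1)) ≤ ω (u i) (u j) / 2 := by
        have := hω.superadd (u i) (u (k + 1)) (u j) (hu (by omega)) (hu (by omega))
        linarith
      have : k + 1 ≤ k := S.le_max' (k + 1) (by
        simp only [S, Finset.mem_filter, Finset.mem_Ico]
        exact ⟨⟨by omega, h⟩, hle⟩)
      omega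
  have hγ0 : 0 ≤ γ := by linarith
  set x := ω (u i) (u j) ^ γ with hx
  have hx0 : 0 ≤ x := Real.rpow_nonneg hW _
  have half : ∀ y, 0 ≤ y → y ≤ ω (u i) (u j) / 2 → y ^ γ ≤ θ * x := by
    intro y hy hy2
    rw [hθdef, hx, ← Real.mul_rpow (by norm_num) hW]
    exact Real.rpow_le_rpow hy (by linarith) hγ0
  have lex : ∀ {p q : ℕ}, i ≤ p → p ≤ q → q ≤ j → ω (u p) (u q) ^ γ ≤ x := fun h1 h2 h3 =>
    Real.rpow_le_rpow (hω.nonneg _ _ (hu h2)) (hω.mono (hu h1) (hu h2) (hu h3)) hγ0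
  have hbx : b * x ≤ κ := le_trans (mul_le_mul_of_nonneg_left
    (Real.rpow_le_rpow hW (hω.mono (hu (Nat.zero_le i)) (hu hij) (hu hjn)) hγ0) hb) hsmall
  have pown : ∀ {p q : ℕ}, p ≤ q → 0 ≤ ω (u p) (u q) ^ γ := fun h =>
    Real.rpow_nonneg (hω.nonneg _ _ (hu h)) _
  set r₁ := ∑ l ∈ Finset.Ico i k, ρ l with hr₁
  set r₂ := ∑ l ∈ Finset.Ico (k + 1) j, ρ l with hr₂
  have hr₁0 : 0 ≤ r₁ := Finset.sum_nonneg fun l _ => hρ l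
  have hr₂0 : 0 ≤ r₂ := Finset.sum_nonneg fun l _ => hρ l
  have hsum : ∑ l ∈ Finset.Ico i j, ρ l = r₁ + ρ k + r₂ := by
    rw [← Finset.sum_Ico_consecutive _ hik hkj.le, Finset.sum_eq_sum_Ico_succ_bot hkj]
    ring
  have half_bound : ∀ {p q : ℕ} {r : ℝ}, 0 ≤ r → p ≤ q → ω (u p) (u q) ≤ ω (u i) (u j) / 2 →
      ‖E p q‖ ≤ A * (ω (u p) (u q) ^ γ) ^ 2 + (1 + 4 * b * ω (u p) (u q) ^ γ) * r →
      ‖E p q‖ ≤ A * (θ ^ 2 * x ^ 2) + (1 + 4 * b * (θ * x)) * r := by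
    intro p q r hr hpq h1 h2
    have h3 := half _ (hω.nonneg _ _ (hu hpq)) h1
    have h4 := pown hpq
    refine h2.trans ?_
    rw [← mul_pow]
    gcongr
  have hEik := half_bound hr₁0 hik hk1 (ih (k - i) (by omega) i k hik (by omega) rfl)
  have hEkj := half_bound hr₂0 (by omega) hk2
    (ih (j - (k + 1)) (by omega) (k + 1) j (by omega) hjn rfl)
  have hd1 : ‖E i j - E i k - E k j‖ ≤ (a * x + b * ‖E i k‖) * x := by
    refine (hδ i k j hik hkj.le hjn).trans ?_
    have h1 := lex le_rfl hik hkj.le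
    have h2 := lex hik hkj.le le_rfl
    have h3 := pown hik
    have h4 := pown hkj.le
    gcongr
  have hρk := hE1 k (by omega)
  have hd2 : ‖E k j - E k (k + 1) - E (k + 1) j‖ ≤ (a * x + b * ρ k) * x := by
    refine (hδ k (k + 1) j (by omega) (by omega) hjn).trans ?_
    have h1 := lex hik (Nat.le_succ k) hkj
    have h2 := lex (by omega) hkj le_rfl
    have h3 := pown hkj
    have h4 := pown (Nat.le_succ k)
    simp only [Nat.succ_eq_add_one] at *
    have := hρ k
    gcongr
  have htri : ‖E i j‖ ≤ ‖E i k‖ + ‖E k (k + 1)‖ + ‖E (k + 1) j‖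
      + ‖E i j - E i k - E k j‖ + ‖E k j - E k (k + 1) - E (k + 1) j‖ := by
    have : E i j = E i k + E k (k + 1) + E (k + 1) j + (E i j - E i k - E k j)
      + (E k j - E k (k + 1) - E (k + 1) j) := by abel
    conv_lhs => rw [this]
    refine (norm_add_le _ _).trans (add_le_add_left ?_ _)
    refine (norm_add_le _ _).trans (add_le_add_left ?_ _)
    refine (norm_add_le _ _).trans (add_le_add_left ?_ _)
    exact norm_add_le _ _
  rw [hsum]
  have := sewing_step hA0 hb hx0 hκ hκ2 hθ0 hθκ hθ34 hAa hr₁0 (hρ k) hr₂0 hbx hEik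
  linarith

/-! ### An a priori estimate for Young differential equations -/

section Young

variable {N d : ℕ} (V : Fin d → EuclideanSpace ℝ (Fin N) → EuclideanSpace ℝ (Fin N))

/-- The linear map `w ↦ ∑ w_α V_α(x)`, that is, the matrix `V(x)` as an operator between Euclidean
spaces. -/
noncomputable def fieldMap (x : EuclideanSpace ℝ (Fin N)) :
    EuclideanSpace ℝ (Fin d) →L[ℝ] EuclideanSpace ℝ (Fin N) :=
  ∑ α, ContinuousLinearMap.smulRightL ℝ _ _ (EuclideanSpace.proj α) (V α x)

theorem fieldMap_apply (x : EuclideanSpace ℝ (Fin N)) (w : EuclideanSpace ℝ (Fin d)) :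
    fieldMap V x w = ∑ α, w α • V α x := by
  simp [fieldMap]

/-- A sequence that runs from `0` to `s` in `m` equal steps, and then from `s` to `t` in `m` equal
steps. -/
noncomputable def twoStage (s t : I) (hst : s ≤ t) (m i : ℕ) : I :=
  ⟨(s : ℝ) * min (1 : ℝ) ((i : ℝ) / m) + ((t : ℝ) - s) * min (1 : ℝ) (((i - m : ℕ) : ℝ) / m), by
    have hs := s.2.1
    have hst' : (0 : ℝ) ≤ t - s := sub_nonneg.2 hst
    positivity, by
    have h1 := mul_le_of_le_one_right s.2.1 (min_le_left (1 : ℝ) ((i : ℝ) / m))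
    have h2 := mul_le_of_le_one_right (sub_nonneg.2 hst : (0 : ℝ) ≤ t - s)
      (min_le_left (1 : ℝ) (((i - m : ℕ) : ℝ) / m))
    have h3 := t.2.2
    linarith⟩

section TwoStage

variable {s t : I} (hst : s ≤ t) {m : ℕ}

theorem twoStage_mono : Monotone (twoStage s t hst m) := by
  intro i j hij
  have hs := s.2.1
  have hst' : (0 : ℝ) ≤ t - s := sub_nonneg.2 hst
  have h1 : (i : ℝ) ≤ j := by exact_mod_cast hij
  have h2 : ((i - m : ℕ) : ℝ) ≤ (j - m : ℕ) := by exact_mod_cast Nat.sub_le_sub_right hij m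
  rw [← Subtype.coe_le_coe]
  simp only [twoStage]
  gcongr

theorem twoStage_zero : twoStage s t hst m 0 = 0 := by
  ext
  simp [twoStage]

theorem twoStage_left (hm : 0 < m) : twoStage s t hst m m = s := by
  ext
  have : (m : ℝ) ≠ 0 := by positivity
  simp [twoStage, this]

theorem twoStage_right (hm : 0 < m) : twoStage s t hst m (m + m) = t := by
  ext
  have h0 : (m : ℝ) ≠ 0 := by positivity
  have h1 : (1 : ℝ) ≤ (m + m) / m := by
    rw [le_div_iff₀ (by positivity)]
    linarith [m.cast_nonneg (α := ℝ)]
  simp [twoStage, h0, h1]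

theorem twoStage_succ_sub_le (i : ℕ) :
    (twoStage s t hst m (i + 1) : ℝ) - twoStage s t hst m i ≤ 1 / m := by
  have hs := s.2.1
  have hs1 := s.2.2
  have ht1 := t.2.2
  have hst' : (0 : ℝ) ≤ t - s := sub_nonneg.2 hst
  have step : ∀ r : ℝ, min 1 ((r + 1) / m) - min 1 (r / m) ≤ 1 / m := by
    intro r
    have h : (0 : ℝ) ≤ 1 / m := by positivity
    rw [add_div]
    rcases min_cases 1 (r / m) with h1 | h1
    · linarith [min_le_left 1 (r / m + 1 / m)]
    · linarith [min_le_right 1 (r / m + 1 / m)]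
  have mono : ∀ r : ℝ, 0 ≤ min 1 ((r + 1) / m) - min 1 (r / m) := by
    intro r
    rw [sub_nonneg]
    gcongr
    linarith
  simp only [twoStage]
  rcases lt_or_ge i m with him | him
  · have h1 : i + 1 - m = 0 := by omega
    have h2 : i - m = 0 := by omega
    rw [h1, h2]
    push_cast
    have := mul_le_mul hs1 (step i) (mono i) zero_le_one
    linarith
  · have hi1 : ((i + 1 - m : ℕ) : ℝ) = ((i - m : ℕ) : ℝ) + 1 := by
      rw [Nat.sub_add_comm him]; push_cast; ring
    rw [hi1]
    rcases Nat.eq_zero_or_pos m with rfl | hm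
    · simp
    have hm' : (0 : ℝ) < m := by exact_mod_cast hm
    have him' : (m : ℝ) ≤ i := by exact_mod_cast him
    have e1 : min (1 : ℝ) (((i + 1 : ℕ) : ℝ) / m) = 1 :=
      min_eq_left ((one_le_div hm').2 (by push_cast; linarith))
    have e2 : min (1 : ℝ) ((i : ℝ) / m) = 1 := min_eq_left ((one_le_div hm').2 him')
    rw [e1, e2]
    have := mul_le_mul (show (t : ℝ) - s ≤ 1 by linarith) (step (i - m : ℕ)) (mono _) zero_le_one
    linarith

end TwoStage

variable {V} {x : EuclideanSpace ℝ (Fin N)} {h : C(I, EuclideanSpace ℝ (Fin d))}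
  {X : C(I, EuclideanSpace ℝ (Fin N))}

theorem exists_one_div_le {δ : ℝ} (hδ : 0 < δ) : ∃ m : ℕ, 0 < m ∧ 1 / (m : ℝ) ≤ δ := by
  obtain ⟨m, hm⟩ := exists_nat_one_div_lt hδ
  exact ⟨m + 1, by omega, by push_cast; exact hm.le⟩

/-- The local expansion of a Young integral equation: sewing applied to the Riemann sums over
refining partitions of `[s, t]`. -/
theorem norm_increment_sub_le (hint : ∀ t, HasYoungIntegral V X h t (X t - x))
    {L : ℝ} (hL0 : 0 ≤ L) (hL : ∀ y z, ‖fieldMap V y - fieldMap V z‖ ≤ L * ‖y - z‖)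
    {ω : I → I → ℝ} (hω : IsControl ω) {γ : ℝ} (hγ : 1 / 2 < γ)
    (hX : ∀ s t, s ≤ t → ‖X t - X s‖ ≤ ω s t ^ γ)
    (hh : ∀ s t, s ≤ t → ‖h t - h s‖ ≤ ω s t ^ γ) {s t : I} (hst : s ≤ t) :
    ‖X t - X s - fieldMap V (X s) (h t - h s)‖ ≤ 2 * L / sewingGap γ * (ω s t ^ γ) ^ 2 := by
  refine le_of_forall_pos_le_add fun ε hε => ?_
  obtain ⟨δ₁, hδ₁, H₁⟩ := hint s (ε / 2) (by positivity)
  obtain ⟨δ₂, hδ₂, H₂⟩ := hint t (ε / 2) (by positivity)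
  obtain ⟨m, hm, hmδ⟩ := exists_one_div_le (lt_min hδ₁ hδ₂)
  set u := twoStage s t hst m with hu
  have humono : Monotone u := twoStage_mono hst
  have hum : u m = s := twoStage_left hst hm
  have hu2 : u (m + m) = t := twoStage_right hst hm
  have hstep := fun i => (twoStage_succ_sub_le hst (m := m) i).trans hmδ
  have hterm : ∀ i, ∑ α : Fin d, (h (u (i + 1)) α - h (u i) α) • V α (X (u i))
      = fieldMap V (X (u i)) (h (u (i + 1)) - h (u i)) := fun i => by
    simp [fieldMap_apply]
  have R₁ := H₁ m u u humono (twoStage_zero hst) hum (fun i _ => (hstep i).trans (min_le_left _ _))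
    (fun i _ => ⟨le_rfl, humono (Nat.le_succ i)⟩)
  have R₂ := H₂ (m + m) u u humono (twoStage_zero hst) hu2
    (fun i _ => (hstep i).trans (min_le_right _ _)) (fun i _ => ⟨le_rfl, humono (Nat.le_succ i)⟩)
  simp only [hterm] at R₁ R₂
  set f : ℕ → EuclideanSpace ℝ (Fin N) := fun i =>
    fieldMap V (X (u i)) (h (u (i + 1)) - h (u i)) with hf
  have key := norm_le_of_discrete_sewing hω humono (n := m + m) (a := L) (b := 0) hγ hL0 le_rfl
    (E := fun i j => ∑ l ∈ Finset.Ico i j, f l - fieldMap V (X (u i)) (h (u j) - h (u i)))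
    (ρ := fun _ => 0) (fun _ => le_rfl) (by simpa using (sewingGap_pos hγ).le) (by simp)
    (fun l _ => by simp [hf])
    (fun i k j hik hkj _ => by
      rw [← Finset.sum_Ico_consecutive f hik hkj]
      have e : ∑ l ∈ Finset.Ico i k, f l + ∑ l ∈ Finset.Ico k j, f l
          - fieldMap V (X (u i)) (h (u j) - h (u i))
          - (∑ l ∈ Finset.Ico i k, f l - fieldMap V (X (u i)) (h (u k) - h (u i)))
          - (∑ l ∈ Finset.Ico k j, f l - fieldMap V (X (u k)) (h (u j) - h (u k)))
          = (fieldMap V (X (u k)) - fieldMap V (X (u i))) (h (u j) - h (u k)) := by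
        simp only [sub_apply, map_sub]
        abel
      rw [e]
      refine (ContinuousLinearMap.le_opNorm _ _).trans ?_
      rw [zero_mul, add_zero]
      have h1 := hX _ _ (humono hik)
      have h2 := hh _ _ (humono hkj)
      have h3 := hL (X (u k)) (X (u i))
      have h4 : 0 ≤ ω (u i) (u k) ^ γ := (norm_nonneg _).trans h1
      exact mul_le_mul (h3.trans (mul_le_mul_of_nonneg_left h1 hL0)) h2 (norm_nonneg _)
        (by positivity))
    (Nat.le_add_right m m) le_rfl
  simp only [hum, hu2, Finset.sum_const_zero, mul_zero, add_zero] at key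
  have hsplit : ∑ i ∈ Finset.range (m + m), f i
      = ∑ i ∈ Finset.range m, f i + ∑ l ∈ Finset.Ico m (m + m), f l := by
    rw [Finset.range_eq_Ico, Finset.range_eq_Ico,
      Finset.sum_Ico_consecutive f (Nat.zero_le _) (Nat.le_add_right _ _)]
  rw [hsplit] at R₂
  have e : X t - X s - fieldMap V (X s) (h t - h s)
      = (∑ l ∈ Finset.Ico m (m + m), f l - fieldMap V (X s) (h t - h s))
        + (∑ i ∈ Finset.range m, f i - (X s - x))
        - (∑ i ∈ Finset.range m, f i + ∑ l ∈ Finset.Ico m (m + m), f l - (X t - x)) := by abel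
  rw [e]
  refine (norm_sub_le _ _).trans ?_
  have := norm_add_le (∑ l ∈ Finset.Ico m (m + m), f l - fieldMap V (X s) (h t - h s))
    (∑ i ∈ Finset.range m, f i - (X s - x))
  linarith

theorem supControl_rpow_le {q p D : ℝ} (hq : 0 < q) (hqp : q ≤ p) {s t : I}
    (hst : s ≤ t) {Φ : ℝ → I → I → ℝ}
    (hΦ : ∀ r a b, Φ r a b = ‖X b - X a‖ ^ r + ‖h b - h a‖ ^ r) {M : ℝ}
    (hM : PartitionSumsLE (Φ q) M)
    (hD : ∀ a b, s ≤ a → a ≤ b → b ≤ t → ‖X b - X a‖ ≤ D ∧ ‖h b - h a‖ ≤ D) :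
    ∀ (n : ℕ) (u : ℕ → I), Monotone u → (∀ i, u i ∈ Icc s t) →
      ∑ i ∈ Finset.range n, Φ p (u i) (u (i + 1)) ≤ D ^ (p - q) * supControl (Φ q) s t := by
  intro n u hu hus
  have hD0 : 0 ≤ D := (norm_nonneg _).trans (hD s s le_rfl le_rfl hst).1
  refine le_trans ?_ (mul_le_mul_of_nonneg_left (hM.sum_le_supControl n hu hus)
    (Real.rpow_nonneg hD0 _))
  rw [Finset.mul_sum]
  refine Finset.sum_le_sum fun i _ => ?_
  obtain ⟨h1, h2⟩ := hD (u i) (u (i + 1)) (hus i).1 (hu (Nat.le_succ i)) (hus _).2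
  have key : ∀ y : ℝ, 0 ≤ y → y ≤ D → y ^ p ≤ D ^ (p - q) * y ^ q := by
    intro y hy hyD
    have : y ^ p = y ^ (p - q) * y ^ q := by
      rw [← Real.rpow_add_of_nonneg hy (by linarith) hq.le]; ring_nf
    rw [this]
    gcongr
  rw [hΦ, hΦ, mul_add]
  exact add_le_add (key _ (norm_nonneg _) h1) (key _ (norm_nonneg _) h2)

/-- Along a fine enough partition the Euler increments of a Young solution have an arbitrarily small
total error: each error is bounded by a power larger than `1` of a control. -/
theorem exists_partition_sum_le (hsol : IsYoungSolution V h x X)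
    {L : ℝ} (hL0 : 0 ≤ L) (hL : ∀ y z, ‖fieldMap V y - fieldMap V z‖ ≤ L * ‖y - z‖)
    {η : ℝ} (hη : 0 < η) :
    ∃ (n : ℕ) (u : ℕ → I), Monotone u ∧ u 0 = 0 ∧ u n = 1 ∧
      ∑ i ∈ Finset.range n,
        ‖X (u (i + 1)) - X (u i) - fieldMap V (X (u i)) (h (u (i + 1)) - h (u i))‖ ≤ η := by
  obtain ⟨⟨q, hq1, hq2, ⟨M₁, hM₁⟩, ⟨M₂, hM₂⟩⟩, hint⟩ := hsol
  -- an exponent strictly between `q` and `2`: raising the exponent gains a power of the oscillation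
  set p := (q + 2) / 2 with hp
  have hqp : q < p := by rw [hp]; linarith
  have hp2 : p < 2 := by rw [hp]; linarith
  have hp0 : 0 < p := by linarith
  let Φ : ℝ → I → I → ℝ := fun r a b => ‖X b - X a‖ ^ r + ‖h b - h a‖ ^ r
  have hΦ : ∀ r a b, Φ r a b = ‖X b - X a‖ ^ r + ‖h b - h a‖ ^ r := fun _ _ _ => rfl
  have hΦ0 : ∀ r s t, s ≤ t → 0 ≤ Φ r s t := fun r s t _ => by simp only [Φ]; positivity
  have hMq : PartitionSumsLE (Φ q) (M₂ + M₁) := fun n u hu => by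
    simp only [Φ, Finset.sum_add_distrib]
    exact add_le_add (hM₂ n u hu) (hM₁ n u hu)
  have hωq := hMq.isControl (hΦ0 q)
  have hMp : PartitionSumsLE (Φ p) ((2 * ‖X‖ + 2 * ‖h‖) ^ (p - q) * supControl (Φ q) 0 1) :=
    fun n u hu => supControl_rpow_le (by linarith) hqp.le (zero_le_one : (0 : I) ≤ 1) hΦ hMq
      (fun a b _ _ _ => by
        have h1 := X.dist_le_two_norm b a
        have h2 := h.dist_le_two_norm b a
        rw [dist_eq_norm] at h1 h2
        have h3 := norm_nonneg X
        have h4 := norm_nonneg h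
        constructor <;> linarith) n u hu
      fun i => ⟨(u i).2.1, (u i).2.2⟩
  have hωp := hMp.isControl (hΦ0 p)
  have hroot : ∀ {y : ℝ} {s t : I}, 0 ≤ y → s ≤ t → y ^ p ≤ Φ p s t →
      y ≤ supControl (Φ p) s t ^ (1 / p) := by
    intro y s t hy hst h1
    rw [one_div, Real.le_rpow_inv_iff_of_pos hy (hωp.nonneg s t hst) hp0]
    exact h1.trans (hMp.le_supControl hst)
  have hγ : 1 / 2 < 1 / p := one_div_lt_one_div_of_lt hp0 hp2
  have hloc := fun {s t : I} (hst : s ≤ t) => norm_increment_sub_le hint hL0 hL hωp hγ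
    (fun s t hst => hroot (norm_nonneg _) hst
      (le_add_of_nonneg_right (Real.rpow_nonneg (norm_nonneg _) _)))
    (fun s t hst => hroot (norm_nonneg _) hst
      (le_add_of_nonneg_left (Real.rpow_nonneg (norm_nonneg _) _)))
    hst
  set C := 2 * L / sewingGap (1 / p) with hC
  have hC0 : 0 ≤ C := div_nonneg (by linarith) (sewingGap_pos hγ).le
  set W := supControl (Φ q) 0 1 with hW
  have hW0 : 0 ≤ W := hωq.nonneg 0 1 zero_le_one
  set K := C * (W ^ (2 / p - 1) * W) with hK
  have hK0 : 0 ≤ K := by positivity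
  have h2p : 0 < 2 / p - 1 := by rw [sub_pos, one_lt_div hp0]; exact hp2
  set a := (p - q) * (2 / p) with ha
  have ha0 : 0 < a := mul_pos (by linarith) (by positivity)
  -- the oscillation `D` for which the total error is at most `D ^ a * K ≤ η`
  set D := (η / (K + 1)) ^ (1 / a) with hD
  have hD0 : 0 < D := by positivity
  have hDa : D ^ a * K ≤ η := by
    rw [hD, ← Real.rpow_mul (by positivity), one_div_mul_cancel ha0.ne', Real.rpow_one,
      div_mul_eq_mul_div, div_le_iff₀ (by positivity)]
    nlinarith
  have hXu := CompactSpace.uniformContinuous_of_continuous X.continuous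
  have hhu := CompactSpace.uniformContinuous_of_continuous h.continuous
  obtain ⟨δ₁, hδ₁, H₁⟩ := Metric.uniformContinuous_iff.1 hXu D hD0
  obtain ⟨δ₂, hδ₂, H₂⟩ := Metric.uniformContinuous_iff.1 hhu D hD0
  obtain ⟨n, hn, hnδ⟩ := exists_one_div_le (half_pos (lt_min hδ₁ hδ₂))
  have hu := twoStage_mono (le_refl (1 : I)) (m := n)
  refine ⟨n, twoStage 1 1 le_rfl n, hu, twoStage_zero _, twoStage_left _ hn, ?_⟩
  set u := twoStage 1 1 le_rfl n with hudef
  have hsmall : ∀ i, supControl (Φ p) (u i) (u (i + 1)) ≤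
      D ^ (p - q) * supControl (Φ q) (u i) (u (i + 1)) := by
    intro i
    refine supControl_le (hu (Nat.le_succ i)) (supControl_rpow_le (by linarith) hqp.le
      (hu (Nat.le_succ i)) hΦ hMq fun a b ha hab hb => ?_)
    have hd : dist b a < min δ₁ δ₂ := by
      rw [Subtype.dist_eq, Real.dist_eq, abs_of_nonneg (sub_nonneg.2 (show (a : ℝ) ≤ b from hab))]
      have h1 := twoStage_succ_sub_le (le_refl (1 : I)) (m := n) i
      have h2 : (u i : ℝ) ≤ a := ha
      have h3 : (b : ℝ) ≤ u (i + 1) := hb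
      have h4 := half_lt_self (lt_min hδ₁ hδ₂)
      linarith
    have h1 := H₁ (hd.trans_le (min_le_left _ _))
    have h2 := H₂ (hd.trans_le (min_le_right _ _))
    rw [dist_eq_norm] at h1 h2
    exact ⟨h1.le, h2.le⟩
  have hterm : ∀ i,
      ‖X (u (i + 1)) - X (u i) - fieldMap V (X (u i)) (h (u (i + 1)) - h (u i))‖ ≤
      D ^ a * (C * W ^ (2 / p - 1)) * supControl (Φ q) (u i) (u (i + 1)) := by
    intro i
    have hle : u i ≤ u (i + 1) := hu (Nat.le_succ i)
    refine (hloc hle).trans ?_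
    have hq0 := hωq.nonneg _ _ hle
    have hqW : supControl (Φ q) (u i) (u (i + 1)) ≤ W :=
      hωq.mono (u i).2.1 hle (u (i + 1)).2.2
    have e1 : (supControl (Φ p) (u i) (u (i + 1)) ^ (1 / p)) ^ 2
        = supControl (Φ p) (u i) (u (i + 1)) ^ (2 / p) := by
      rw [← Real.rpow_natCast, ← Real.rpow_mul (hωp.nonneg _ _ hle)]
      congr 1
      push_cast
      ring
    have e2 : supControl (Φ p) (u i) (u (i + 1)) ^ (2 / p) ≤
        D ^ a * supControl (Φ q) (u i) (u (i + 1)) ^ (2 / p) := by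
      rw [ha, Real.rpow_mul hD0.le, ← Real.mul_rpow (by positivity) hq0]
      exact Real.rpow_le_rpow (hωp.nonneg _ _ hle) (hsmall i) (by positivity)
    have e3 : supControl (Φ q) (u i) (u (i + 1)) ^ (2 / p) ≤
        W ^ (2 / p - 1) * supControl (Φ q) (u i) (u (i + 1)) := by
      have : supControl (Φ q) (u i) (u (i + 1)) ^ (2 / p)
          = supControl (Φ q) (u i) (u (i + 1)) ^ (2 / p - 1)
            * supControl (Φ q) (u i) (u (i + 1)) := by
        nth_rewrite 3 [← Real.rpow_one (supControl (Φ q) (u i) (u (i + 1)))]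
        rw [← Real.rpow_add_of_nonneg hq0 h2p.le zero_le_one, sub_add_cancel]
      rw [this]
      gcongr
    rw [e1]
    calc C * supControl (Φ p) (u i) (u (i + 1)) ^ (2 / p)
        ≤ C * (D ^ a * (W ^ (2 / p - 1) * supControl (Φ q) (u i) (u (i + 1)))) := by
          gcongr
          exact e2.trans (by gcongr)
      _ = _ := by ring
  refine (Finset.sum_le_sum fun i _ => hterm i).trans ?_
  rw [← Finset.mul_sum]
  have hsum := hωq.sum_le hu n
  rw [show u 0 = 0 from twoStage_zero _, show u n = 1 from twoStage_left _ hn] at hsum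
  calc _ ≤ D ^ a * (C * W ^ (2 / p - 1)) * W := by gcongr
    _ = D ^ a * K := by rw [hK]; ring
    _ ≤ η := hDa

theorem IsYoungSolution.apply_zero (hsol : IsYoungSolution V h x X) : X 0 = x := by
  have : ‖X 0 - x‖ ≤ 0 := by
    refine le_of_forall_pos_le_add fun ε hε => ?_
    obtain ⟨δ, hδ, H⟩ := hsol.2 0 ε hε
    have := H 0 (fun _ => 0) (fun _ => 0) monotone_const rfl rfl (by simp) (by simp)
    simpa [norm_sub_rev] using this
  exact sub_eq_zero.1 (norm_le_zero_iff.1 this)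

/-- If the driving path is `γ`-regular with respect to a control for some `γ > 1/2`, with a small
constant, then every Young solution moves by at most a multiple of that constant. The `q`-variation
of the solution only enters through `exists_partition_sum_le`, not in the bound. -/
theorem IsYoungSolution.norm_sub_le (hsol : IsYoungSolution V h x X)
    {L M : ℝ} (hL0 : 0 ≤ L) (hL : ∀ y z, ‖fieldMap V y - fieldMap V z‖ ≤ L * ‖y - z‖)
    (hM0 : 0 ≤ M) (hM : ∀ y, ‖fieldMap V y‖ ≤ M)
    {ω : I → I → ℝ} (hω : IsControl ω) {γ K : ℝ} (hγ : 1 / 2 < γ) (hK : 0 ≤ K)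
    (hh : ∀ s t, s ≤ t → ‖h t - h s‖ ≤ K * ω s t ^ γ)
    (hsmall : L * K * ω 0 1 ^ γ ≤ sewingGap γ) :
    ‖X 1 - x‖ ≤ 3 * (M * K * ω 0 1 ^ γ) := by
  refine le_of_forall_pos_le_add fun η hη => ?_
  obtain ⟨n, u, hu, hu0, hun, hsum⟩ := exists_partition_sum_le hsol hL0 hL
    (show 0 < η / 3 by positivity)
  have hinc : ∀ i j, i ≤ j → ‖fieldMap V (X (u i)) (h (u j) - h (u i))‖ ≤
      M * K * ω (u i) (u j) ^ γ := fun i j hij => by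
    refine (ContinuousLinearMap.le_opNorm _ _).trans ?_
    rw [mul_assoc]
    exact mul_le_mul (hM _) (hh _ _ (hu hij)) (norm_nonneg _) hM0
  have key := norm_le_of_discrete_sewing hω hu (n := n) (a := L * K * (M * K)) (b := L * K) hγ
    (by positivity) (by positivity)
    (E := fun i j => X (u j) - X (u i) - fieldMap V (X (u i)) (h (u j) - h (u i)))
    (ρ := fun i => ‖X (u (i + 1)) - X (u i) - fieldMap V (X (u i)) (h (u (i + 1)) - h (u i))‖)
    (fun _ => norm_nonneg _) (by rwa [hu0, hun]) (by simp) (fun l _ => le_rfl)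
    (fun i k j hik hkj _ => by
      have e : X (u j) - X (u i) - fieldMap V (X (u i)) (h (u j) - h (u i))
          - (X (u k) - X (u i) - fieldMap V (X (u i)) (h (u k) - h (u i)))
          - (X (u j) - X (u k) - fieldMap V (X (u k)) (h (u j) - h (u k)))
          = (fieldMap V (X (u k)) - fieldMap V (X (u i))) (h (u j) - h (u k)) := by
        simp only [sub_apply, map_sub]
        abel
      rw [e]
      refine (ContinuousLinearMap.le_opNorm _ _).trans ?_
      have h1 := hL (X (u k)) (X (u i))
      have h2 := hh _ _ (hu hkj)
      have h3 : ‖X (u k) - X (u i)‖ ≤ M * K * ω (u i) (u k) ^ γ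
          + ‖X (u k) - X (u i) - fieldMap V (X (u i)) (h (u k) - h (u i))‖ := by
        have h4 := norm_add_le (fieldMap V (X (u i)) (h (u k) - h (u i)))
          (X (u k) - X (u i) - fieldMap V (X (u i)) (h (u k) - h (u i)))
        rw [add_sub_cancel] at h4
        linarith [hinc i k hik]
      have h5 := (norm_nonneg _).trans h2
      calc _ ≤ L * ‖X (u k) - X (u i)‖ * (K * ω (u k) (u j) ^ γ) := by gcongr
        _ ≤ L * (M * K * ω (u i) (u k) ^ γ
          + ‖X (u k) - X (u i) - fieldMap V (X (u i)) (h (u k) - h (u i))‖)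
            * (K * ω (u k) (u j) ^ γ) := by gcongr
        _ = _ := by ring)
    (Nat.zero_le n) le_rfl
  have hfirst := hinc 0 n (Nat.zero_le n)
  simp only [hu0, hun, ← Finset.range_eq_Ico] at key hfirst
  rw [hsol.apply_zero] at key hfirst
  set y := ω 0 1 ^ γ with hy
  have hy0 : 0 ≤ y := Real.rpow_nonneg (hω.nonneg 0 1 zero_le_one) _
  have hκ := sewingGap_pos hγ
  have hquad : 2 * (L * K * (M * K)) / sewingGap γ * y ^ 2 ≤ 2 * (M * K * y) := by
    rw [div_mul_eq_mul_div, div_le_iff₀ hκ]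
    calc 2 * (L * K * (M * K)) * y ^ 2 = 2 * (M * K * y) * (L * K * y) := by ring
      _ ≤ _ := by gcongr
  have h4 := norm_add_le (fieldMap V x (h 1 - h 0)) (X 1 - x - fieldMap V x (h 1 - h 0))
  rw [add_sub_cancel] at h4
  linarith

end Young

/-! ### Variation of Cameron--Martin paths -/

section Variation

theorem rpow_add_rpow_le {p x a b : ℝ} (hp0 : 0 ≤ p) (hp1 : p ≤ 1) (hx : 0 ≤ x) (ha : 0 ≤ a)
    (hb : 0 ≤ b) : x ^ p + (x + a + b) ^ p ≤ (x + a) ^ p + (x + b) ^ p := by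
  rcases (add_nonneg ha hb).eq_or_lt with h | h
  · have ha' : a = 0 := by linarith
    have hb' : b = 0 := by linarith
    simp [ha', hb']
  have hc := (Real.concaveOn_rpow hp0 hp1).2 (x := x) (y := x + a + b) hx
    (show (0 : ℝ) ≤ x + a + b by positivity)
  have h1 := hc (a := b / (a + b)) (b := a / (a + b)) (by positivity) (by positivity)
    (by field_simp; ring)
  have h2 := hc (a := a / (a + b)) (b := b / (a + b)) (by positivity) (by positivity)
    (by field_simp)
  simp only [smul_eq_mul] at h1 h2
  have e1 : b / (a + b) * x + a / (a + b) * (x + a + b) = x + a := by field_simp; ring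
  have e2 : a / (a + b) * x + b / (a + b) * (x + a + b) = x + b := by field_simp; ring
  rw [e1] at h1
  rw [e2] at h2
  have e3 : x ^ p + (x + a + b) ^ p = b / (a + b) * x ^ p + a / (a + b) * (x + a + b) ^ p
      + (a / (a + b) * x ^ p + b / (a + b) * (x + a + b) ^ p) := by field_simp; ring
  linarith

variable {E : Type*} [NormedAddCommGroup E] [InnerProductSpace ℝ E]

/-- A Gram matrix with nonpositive off-diagonal entries and nonnegative row sums is at most twice
its diagonal. -/
theorem norm_sum_smul_sq_le {n : ℕ} (D : ℕ → E) (b : ℕ → ℝ)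
    (hoff : ∀ k l, k ≠ l → inner ℝ (D k) (D l) ≤ 0)
    (hrow : ∀ k < n, 0 ≤ inner ℝ (D k) (∑ l ∈ Finset.range n, D l)) :
    ‖∑ k ∈ Finset.range n, b k • D k‖ ^ 2 ≤ 2 * ∑ k ∈ Finset.range n, b k ^ 2 * ‖D k‖ ^ 2 := by
  have habs : ∀ k l, |inner ℝ (D k) (D l)| =
      (if k = l then 2 * ‖D k‖ ^ 2 else 0) - inner ℝ (D k) (D l) := by
    intro k l
    split_ifs with h
    · subst h
      rw [real_inner_self_eq_norm_sq, abs_of_nonneg (by positivity)]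
      ring
    · rw [abs_of_nonpos (hoff k l h), zero_sub]
  have hrowabs : ∀ k ∈ Finset.range n,
      ∑ l ∈ Finset.range n, |inner ℝ (D k) (D l)| ≤ 2 * ‖D k‖ ^ 2 := by
    intro k hk
    simp only [habs, Finset.sum_sub_distrib, Finset.sum_ite_eq, if_pos hk]
    have := hrow k (Finset.mem_range.1 hk)
    rw [inner_sum] at this
    linarith
  have hterm : ∀ k l, b k * (b l * inner ℝ (D k) (D l)) ≤
      b k ^ 2 / 2 * |inner ℝ (D k) (D l)| + b l ^ 2 / 2 * |inner ℝ (D l) (D k)| := by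
    intro k l
    rw [real_inner_comm (D k) (D l)]
    have h1 : b k * b l * inner ℝ (D k) (D l) ≤ |b k * b l| * |inner ℝ (D k) (D l)| := by
      rw [← abs_mul]; exact le_abs_self _
    have h2 : |b k * b l| ≤ b k ^ 2 / 2 + b l ^ 2 / 2 := by
      rw [abs_le]
      constructor <;> nlinarith [sq_nonneg (b k + b l), sq_nonneg (b k - b l)]
    have h3 := mul_le_mul_of_nonneg_right h2 (abs_nonneg (inner ℝ (D k) (D l)))
    linarith
  have hexp : ‖∑ k ∈ Finset.range n, b k • D k‖ ^ 2 =
      ∑ k ∈ Finset.range n, ∑ l ∈ Finset.range n, b k * (b l * inner ℝ (D k) (D l)) := by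
    rw [← real_inner_self_eq_norm_sq, sum_inner]
    refine Finset.sum_congr rfl fun k _ => ?_
    rw [inner_sum]
    refine Finset.sum_congr rfl fun l _ => ?_
    rw [real_inner_smul_left, real_inner_smul_right]
  rw [hexp]
  calc _ ≤ ∑ k ∈ Finset.range n, ∑ l ∈ Finset.range n,
        (b k ^ 2 / 2 * |inner ℝ (D k) (D l)| + b l ^ 2 / 2 * |inner ℝ (D l) (D k)|) :=
      Finset.sum_le_sum fun k _ => Finset.sum_le_sum fun l _ => hterm k l
    _ = ∑ k ∈ Finset.range n, b k ^ 2 * ∑ l ∈ Finset.range n, |inner ℝ (D k) (D l)| := by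
      simp only [Finset.sum_add_distrib]
      rw [Finset.sum_comm (f := fun k l => b l ^ 2 / 2 * |inner ℝ (D l) (D k)|),
        ← Finset.sum_add_distrib]
      refine Finset.sum_congr rfl fun k _ => ?_
      rw [← Finset.sum_add_distrib, Finset.mul_sum]
      refine Finset.sum_congr rfl fun l _ => ?_
      ring
    _ ≤ ∑ k ∈ Finset.range n, b k ^ 2 * (2 * ‖D k‖ ^ 2) :=
      Finset.sum_le_sum fun k hk => mul_le_mul_of_nonneg_left (hrowabs k hk) (sq_nonneg _)
    _ = _ := by
      rw [Finset.mul_sum]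
      exact Finset.sum_congr rfl fun k _ => by ring

variable {H : ℝ} {β : I → E}

theorem inner_increments (hβ : ∀ s t, inner ℝ (β s) (β t) = cov H s t) (a b s t : I) :
    inner ℝ (β b - β a) (β t - β s) = (1 / 2) * (|(b : ℝ) - s| ^ (2 * H)
      + |(a : ℝ) - t| ^ (2 * H) - |(b : ℝ) - t| ^ (2 * H) - |(a : ℝ) - s| ^ (2 * H)) := by
  rw [inner_sub_left, inner_sub_right, inner_sub_right, hβ, hβ, hβ, hβ]
  simp only [cov]
  ring

theorem norm_increment_sq (hH : 0 < H) (hβ : ∀ s t, inner ℝ (β s) (β t) = cov H s t) {s t : I}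
    (hst : s ≤ t) : ‖β t - β s‖ ^ 2 = ((t : ℝ) - s) ^ (2 * H) := by
  have hst' : (0 : ℝ) ≤ t - s := sub_nonneg.2 hst
  rw [← real_inner_self_eq_norm_sq, inner_increments hβ, abs_sub_comm (s : ℝ) t,
    abs_of_nonneg hst', sub_self, sub_self, abs_zero, Real.zero_rpow (by linarith)]
  ring

/-- For `H ≤ 1/2` the increments over disjoint intervals are negatively correlated. -/
theorem inner_increments_nonpos (hH : 0 < H) (hH2 : H ≤ 1 / 2)
    (hβ : ∀ s t, inner ℝ (β s) (β t) = cov H s t) {s t a b : I} (hst : s ≤ t) (hta : t ≤ a)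
    (hab : a ≤ b) : inner ℝ (β b - β a) (β t - β s) ≤ 0 := by
  have h1 : (0 : ℝ) ≤ t - s := sub_nonneg.2 hst
  have h2 : (0 : ℝ) ≤ a - t := sub_nonneg.2 hta
  have h3 : (0 : ℝ) ≤ b - a := sub_nonneg.2 hab
  rw [inner_increments hβ, abs_of_nonneg (by linarith : (0 : ℝ) ≤ b - s), abs_of_nonneg h2,
    abs_of_nonneg (by linarith : (0 : ℝ) ≤ b - t), abs_of_nonneg (by linarith : (0 : ℝ) ≤ a - s)]
  have := rpow_add_rpow_le (p := 2 * H) (by linarith) (by linarith) h2 h3 h1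
  have e1 : (a : ℝ) - t + (b - a) + (t - s) = b - s := by ring
  have e2 : (a : ℝ) - t + (b - a) = b - t := by ring
  have e3 : (a : ℝ) - t + (t - s) = a - s := by ring
  rw [e1, e2, e3] at this
  linarith

theorem inner_increments_nonneg (hH : 0 < H)
    (hβ : ∀ s t, inner ℝ (β s) (β t) = cov H s t) {s t a b : I} (has : a ≤ s) (hst : s ≤ t)
    (htb : t ≤ b) : 0 ≤ inner ℝ (β t - β s) (β b - β a) := by
  have h1 : (0 : ℝ) ≤ t - s := sub_nonneg.2 hst
  have h2 : (0 : ℝ) ≤ s - a := sub_nonneg.2 has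
  have h3 : (0 : ℝ) ≤ b - t := sub_nonneg.2 htb
  rw [inner_increments hβ, abs_sub_comm (s : ℝ) b, abs_sub_comm (t : ℝ) b,
    abs_of_nonneg (by linarith : (0 : ℝ) ≤ t - a), abs_of_nonneg (by linarith : (0 : ℝ) ≤ b - s),
    abs_of_nonneg h2, abs_of_nonneg h3]
  have e1 : ((s : ℝ) - a) ^ (2 * H) ≤ ((t : ℝ) - a) ^ (2 * H) :=
    Real.rpow_le_rpow h2 (by linarith) (by linarith)
  have e2 : ((b : ℝ) - t) ^ (2 * H) ≤ ((b : ℝ) - s) ^ (2 * H) :=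
    Real.rpow_le_rpow h3 (by linarith) (by linarith)
  linarith

/-- The Riesz-type variation of a scalar Cameron--Martin path for `H ≤ 1/2`, by duality with the
increments of the Gaussian process. -/
theorem sum_sq_div_le (hH : 0 < H) (hH2 : H ≤ 1 / 2)
    (hβ : ∀ s t, inner ℝ (β s) (β t) = cov H s t) (Z : E) (n : ℕ) {u : ℕ → I} (hu : Monotone u) :
    ∑ k ∈ Finset.range n, inner ℝ (β (u (k + 1)) - β (u k)) Z ^ 2
      / ((u (k + 1) : ℝ) - u k) ^ (2 * H) ≤ 2 * ‖Z‖ ^ 2 := by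
  set D : ℕ → E := fun k => β (u (k + 1)) - β (u k) with hD
  set Δ : ℕ → ℝ := fun k => ((u (k + 1) : ℝ) - u k) ^ (2 * H) with hΔ
  have hDΔ : ∀ k, ‖D k‖ ^ 2 = Δ k := fun k => norm_increment_sq hH hβ (hu (Nat.le_succ k))
  -- the test coefficients for which the dual pairing is the sum itself
  set b : ℕ → ℝ := fun k => inner ℝ (D k) Z / Δ k with hb
  set S := ∑ k ∈ Finset.range n, inner ℝ (D k) Z ^ 2 / Δ k with hS
  change S ≤ _
  have hoff : ∀ k l, k ≠ l → inner ℝ (D k) (D l) ≤ 0 := by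
    have : ∀ k l, k < l → inner ℝ (D l) (D k) ≤ 0 := fun k l hkl =>
      inner_increments_nonpos hH hH2 hβ (hu (Nat.le_succ k)) (hu hkl) (hu (Nat.le_succ l))
    intro k l hkl
    rcases hkl.lt_or_gt with h | h
    · rw [real_inner_comm]; exact this k l h
    · exact this l k h
  have hrow : ∀ k < n, 0 ≤ inner ℝ (D k) (∑ l ∈ Finset.range n, D l) := by
    intro k hk
    rw [Finset.sum_range_sub (fun k => β (u k))]
    exact inner_increments_nonneg hH hβ (hu (Nat.zero_le k)) (hu (Nat.le_succ k)) (hu hk)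
  have h1 := norm_sum_smul_sq_le D b hoff hrow
  have h2 : ∑ k ∈ Finset.range n, b k ^ 2 * ‖D k‖ ^ 2 = S := by
    refine Finset.sum_congr rfl fun k _ => ?_
    rw [hDΔ, hb]
    rcases eq_or_ne (Δ k) 0 with h | h
    · simp [h]
    · field_simp
  have h3 : inner ℝ (∑ k ∈ Finset.range n, b k • D k) Z = S := by
    rw [sum_inner]
    refine Finset.sum_congr rfl fun k _ => ?_
    rw [real_inner_smul_left, hb]
    ring
  rw [h2] at h1
  have h4 := real_inner_le_norm (∑ k ∈ Finset.range n, b k • D k) Z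
  rw [h3] at h4
  have hS0 : 0 ≤ S := Finset.sum_nonneg fun k _ =>
    div_nonneg (sq_nonneg _) (by rw [← hDΔ]; positivity)
  have h5 : S ^ 2 ≤ 2 * S * ‖Z‖ ^ 2 := by
    calc S ^ 2 ≤ (‖∑ k ∈ Finset.range n, b k • D k‖ * ‖Z‖) ^ 2 := by gcongr
      _ = ‖∑ k ∈ Finset.range n, b k • D k‖ ^ 2 * ‖Z‖ ^ 2 := by ring
      _ ≤ _ := by gcongr
  rcases hS0.eq_or_lt with h | h
  · rw [← h]; positivity
  · nlinarith

/-- The regularity exponent of Cameron--Martin paths used here: `1/2 + H` for `H ≤ 1/2`, where a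
control is needed, and the Hölder exponent `H` otherwise. -/
noncomputable def pathExponent (H : ℝ) : ℝ := if H ≤ 1 / 2 then 1 / 2 + H else H

theorem half_lt_pathExponent (hH : 0 < H) : 1 / 2 < pathExponent H := by
  unfold pathExponent
  split_ifs with h <;> linarith

theorem exists_isControl {d : ℕ} (hH : 0 < H) {b : I → Fin d → E}
    (hb : ∀ s t i, inner ℝ (b s i) (b t i) = cov H s t) {Z : E}
    {h : I → EuclideanSpace ℝ (Fin d)} (hh : ∀ t i, h t i = inner ℝ (b t i) Z) :
    ∃ ω : I → I → ℝ, IsControl ω ∧ ω 0 1 ≤ d + 1 ∧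
      ∀ s t, s ≤ t → ‖h t - h s‖ ≤ (d + 2) * ‖Z‖ * ω s t ^ pathExponent H := by
  have hinc : ∀ s t i, (h t - h s) i = inner ℝ (b t i - b s i) Z := fun s t i => by
    rw [inner_sub_left, ← hh, ← hh]; rfl
  have hnorm : ∀ s t, ‖h t - h s‖ ^ 2 = ∑ i, inner ℝ (b t i - b s i) Z ^ 2 := fun s t => by
    rw [EuclideanSpace.norm_sq_eq]
    exact Finset.sum_congr rfl fun i _ => by rw [hinc, Real.norm_eq_abs, sq_abs]
  have hd0 : (0 : ℝ) ≤ d := d.cast_nonneg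
  unfold pathExponent
  split_ifs with hH2
  · let Φ : I → I → ℝ := fun s t => ∑ i, inner ℝ (b t i - b s i) Z ^ 2
      / ((t : ℝ) - s) ^ (2 * H) / (2 * ‖Z‖ ^ 2)
    have hΦ0 : ∀ s t, s ≤ t → 0 ≤ Φ s t := fun s t hst => by
      have : (0 : ℝ) ≤ t - s := sub_nonneg.2 hst
      exact Finset.sum_nonneg fun i _ => by positivity
    have hM : PartitionSumsLE Φ d := by
      intro n u hu
      simp only [Φ]
      rw [Finset.sum_comm]
      calc _ ≤ ∑ i : Fin d, (1 : ℝ) := Finset.sum_le_sum fun i _ => by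
            rw [← Finset.sum_div]
            exact div_le_one_of_le₀ (sum_sq_div_le hH hH2 (fun s t => hb s t i) Z n hu)
              (by positivity)
        _ = d := by simp
    refine ⟨_, (hM.isControl hΦ0).add isControl_sub, ?_, fun s t hst => ?_⟩
    · have := hM.supControl_le (zero_le_one : (0 : I) ≤ 1)
      simp only [Icc.coe_one, Icc.coe_zero]
      linarith
    · have hst' : (0 : ℝ) ≤ t - s := sub_nonneg.2 hst
      set w := supControl Φ s t + ((t : ℝ) - s) with hw
      have hc := hM.supControl_nonneg hst
      have hΦw : Φ s t ≤ w := by have := hM.le_supControl hst; linarith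
      have hw0 : 0 ≤ w := by positivity
      have hwpow : (w ^ (1 / 2 + H)) ^ 2 = w * w ^ (2 * H) := by
        rw [← Real.rpow_natCast, ← Real.rpow_mul hw0]
        nth_rewrite 2 [← Real.rpow_one w]
        rw [← Real.rpow_add_of_nonneg hw0 zero_le_one (by linarith)]
        congr 1
        push_cast
        ring
      refine abs_le_of_sq_le_sq' ?_ (by positivity) |>.2
      have hcoord : ∀ i, inner ℝ (b t i - b s i) Z ^ 2 = inner ℝ (b t i - b s i) Z ^ 2
          / ((t : ℝ) - s) ^ (2 * H) / (2 * ‖Z‖ ^ 2) * (2 * ‖Z‖ ^ 2 * ((t : ℝ) - s) ^ (2 * H)) := by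
        intro i
        rcases hst.eq_or_lt with rfl | hlt
        · simp
        rcases eq_or_ne Z 0 with rfl | hZ
        · simp
        have h1 : ((t : ℝ) - s) ^ (2 * H) ≠ 0 := (Real.rpow_pos_of_pos (sub_pos.2 hlt) _).ne'
        have h2 : ‖Z‖ ≠ 0 := norm_ne_zero_iff.2 hZ
        field_simp
      calc ‖h t - h s‖ ^ 2 = Φ s t * (2 * ‖Z‖ ^ 2 * ((t : ℝ) - s) ^ (2 * H)) := by
            rw [hnorm, Finset.sum_mul]
            exact Finset.sum_congr rfl fun i _ => hcoord i
        _ ≤ w * (((d + 2) * ‖Z‖) ^ 2 * w ^ (2 * H)) := by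
            have h1 : ((t : ℝ) - s) ^ (2 * H) ≤ w ^ (2 * H) :=
              Real.rpow_le_rpow hst' (by linarith) (by linarith)
            have h2 : 2 * ‖Z‖ ^ 2 ≤ ((d + 2) * ‖Z‖) ^ 2 := by
              rw [mul_pow]
              exact mul_le_mul_of_nonneg_right (by nlinarith) (sq_nonneg _)
            gcongr
        _ = _ := by rw [mul_pow _ (w ^ (1 / 2 + H)), hwpow]; ring
  · refine ⟨_, isControl_sub, by simp, fun s t hst => ?_⟩
    have hst' : (0 : ℝ) ≤ t - s := sub_nonneg.2 hst
    refine abs_le_of_sq_le_sq' ?_ (by positivity) |>.2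
    have hcoord : ∀ i, inner ℝ (b t i - b s i) Z ^ 2 ≤ ((t : ℝ) - s) ^ (2 * H) * ‖Z‖ ^ 2 := by
      intro i
      rw [← norm_increment_sq hH (fun s t => hb s t i) hst, ← mul_pow, ← sq_abs]
      gcongr
      exact abs_real_inner_le_norm _ _
    have e : (((t : ℝ) - s) ^ H) ^ 2 = ((t : ℝ) - s) ^ (2 * H) := by
      rw [← Real.rpow_natCast, ← Real.rpow_mul hst', mul_comm]
      norm_num
    calc ‖h t - h s‖ ^ 2 ≤ ∑ i : Fin d, ((t : ℝ) - s) ^ (2 * H) * ‖Z‖ ^ 2 := by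
          rw [hnorm]
          exact Finset.sum_le_sum fun i _ => hcoord i
      _ = d * (((t : ℝ) - s) ^ (2 * H) * ‖Z‖ ^ 2) := by simp
      _ ≤ (d + 2) ^ 2 * (((t : ℝ) - s) ^ (2 * H) * ‖Z‖ ^ 2) := by
          gcongr
          nlinarith
      _ = _ := by rw [mul_pow _ (((t : ℝ) - s) ^ H), e]; ring

end Variation

/-! ### The first chaos as a Hilbert space -/

section Chaos

variable {Ω : Type*} [MeasurableSpace Ω] {P : Measure Ω} {d : ℕ}
  {B : I → Ω → EuclideanSpace ℝ (Fin d)} {H : ℝ}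

theorem IsFractionalBrownianMotion.memLp (hB : IsFractionalBrownianMotion P H B) (t : I)
    (i : Fin d) : MemLp (fun ω => B t ω i) 2 P :=
  ((hB.gaussian.hasGaussianLaw_eval t).map (EuclideanSpace.proj (𝕜 := ℝ) i)).memLp_two

/-- The random variable `B_t^i` as an element of `L²(P)`. -/
noncomputable def IsFractionalBrownianMotion.evalLp (hB : IsFractionalBrownianMotion P H B) (t : I)
    (i : Fin d) : Lp ℝ 2 P :=
  (hB.memLp t i).toLp _

namespace IsFractionalBrownianMotion

variable (hB : IsFractionalBrownianMotion P H B)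

theorem evalLp_ae_eq (t : I) (i : Fin d) : hB.evalLp t i =ᵐ[P] fun ω => B t ω i :=
  (hB.memLp t i).coeFn_toLp

theorem inner_evalLp (t : I) (i : Fin d) (Z : Lp ℝ 2 P) :
    inner ℝ (hB.evalLp t i) Z = ∫ ω, B t ω i * Z ω ∂P := by
  rw [L2.inner_def]
  refine integral_congr_ae ?_
  filter_upwards [hB.evalLp_ae_eq t i] with ω hω
  simp [hω, mul_comm]

theorem inner_evalLp_evalLp (s t : I) (i j : Fin d) :
    inner ℝ (hB.evalLp s i) (hB.evalLp t j) = if i = j then cov H s t else 0 := by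
  rw [inner_evalLp, ← hB.covariance]
  refine integral_congr_ae ?_
  filter_upwards [hB.evalLp_ae_eq t j] with ω hω
  rw [hω]

theorem firstChaos_eq : firstChaos P B =
    (Submodule.span ℝ (range fun p : I × Fin d => hB.evalLp p.1 p.2)).topologicalClosure := by
  unfold firstChaos
  congr 2
  ext W
  constructor
  · rintro ⟨t, i, hW⟩
    exact ⟨(t, i), Lp.ext ((hB.evalLp_ae_eq t i).trans hW.symm)⟩
  · rintro ⟨⟨t, i⟩, rfl⟩
    exact ⟨t, i, hB.evalLp_ae_eq t i⟩

end IsFractionalBrownianMotion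

end Chaos

/-! ### The spectral representation of the covariance -/

section Spectral

open FourierTransform

variable {H : ℝ}

/-- The integral `∫ (1 - cos(2π t ξ)) |ξ|^{-1-2H} dξ`, a multiple of `|t|^{2H}`. -/
noncomputable def spectralIntegral (H t : ℝ) : ℝ :=
  ∫ ξ : ℝ, (1 - Real.cos (2 * Real.pi * (t * ξ))) * |ξ| ^ (-1 - 2 * H)

theorem integrable_spectral (hH0 : 0 < H) (hH1 : H < 1) (t : ℝ) :
    Integrable fun ξ : ℝ => (1 - Real.cos (2 * Real.pi * (t * ξ))) * |ξ| ^ (-1 - 2 * H) := by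
  set F : ℝ → ℝ := fun ξ => (1 - Real.cos (2 * Real.pi * (t * ξ))) * |ξ| ^ (-1 - 2 * H) with hF
  have hmeas : Measurable F := by fun_prop
  have hnn : ∀ ξ, 0 ≤ 1 - Real.cos (2 * Real.pi * (t * ξ)) := fun ξ =>
    sub_nonneg.2 (Real.cos_le_one _)
  have h1 : IntegrableOn F (Ioc 0 1) := by
    have hi : IntegrableOn (fun ξ : ℝ => (2 * Real.pi * t) ^ 2 / 2 * ξ ^ (1 - 2 * H)) (Ioc 0 1) :=
      ((intervalIntegrable_iff_integrableOn_Ioc_of_le (zero_le_one' ℝ)).1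
        (intervalIntegral.intervalIntegrable_rpow' (by linarith))).const_mul _
    refine hi.mono' hmeas.aestronglyMeasurable ?_
    filter_upwards [ae_restrict_mem measurableSet_Ioc] with ξ hξ
    have hξ0 : 0 < ξ := hξ.1
    have e : ξ ^ (1 - 2 * H) = ξ ^ 2 * ξ ^ (-1 - 2 * H) := by
      rw [← Real.rpow_natCast, ← Real.rpow_add hξ0]
      congr 1
      push_cast
      ring
    rw [Real.norm_eq_abs, hF, abs_of_nonneg (mul_nonneg (hnn ξ) (by positivity)),
      abs_of_pos hξ0, e]
    have hcos := Real.one_sub_sq_div_two_le_cos (x := 2 * Real.pi * (t * ξ))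
    have hle : 1 - Real.cos (2 * Real.pi * (t * ξ)) ≤ (2 * Real.pi * t) ^ 2 / 2 * ξ ^ 2 := by
      linarith
    have := mul_le_mul_of_nonneg_right hle (Real.rpow_nonneg hξ0.le (-1 - 2 * H))
    linarith
  have h2 : IntegrableOn F (Ioi 1) := by
    have hi : IntegrableOn (fun ξ : ℝ => 2 * ξ ^ (-1 - 2 * H)) (Ioi 1) :=
      (integrableOn_Ioi_rpow_of_lt (by linarith) zero_lt_one).const_mul _
    refine hi.mono' hmeas.aestronglyMeasurable ?_
    filter_upwards [ae_restrict_mem measurableSet_Ioi] with ξ hξ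
    have hξ0 : 0 < ξ := zero_lt_one.trans hξ
    rw [Real.norm_eq_abs, hF, abs_of_nonneg (mul_nonneg (hnn ξ) (by positivity)),
      abs_of_pos hξ0]
    refine mul_le_mul_of_nonneg_right ?_ (by positivity)
    linarith [Real.neg_one_le_cos (2 * Real.pi * (t * ξ))]
  have h3 : Integrable ((Ioi (0 : ℝ)).indicator F) := by
    rw [integrable_indicator_iff measurableSet_Ioi, ← Ioc_union_Ioi_eq_Ioi zero_le_one]
    exact h1.union h2
  have h4 : F = (Ioi (0 : ℝ)).indicator F + fun ξ => (Ioi (0 : ℝ)).indicator F (-ξ) := by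
    ext ξ
    have heven : F (-ξ) = F ξ := by simp only [hF, mul_neg, Real.cos_neg, abs_neg]
    rw [Pi.add_apply]
    rcases lt_trichotomy ξ 0 with h | h | h
    · rw [indicator_of_notMem (by simpa using h.le), indicator_of_mem (by simpa using h), heven,
        zero_add]
    · subst h
      simp [hF]
    · rw [indicator_of_mem (by simpa using h), indicator_of_notMem (by simpa using h.le), add_zero]
  rw [h4]
  exact h3.add h3.comp_neg

theorem spectralIntegral_eq (hH0 : 0 < H) (t : ℝ) :
    spectralIntegral H t = |t| ^ (2 * H) * spectralIntegral H 1 := by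
  rcases eq_or_ne t 0 with rfl | ht
  · rw [abs_zero, Real.zero_rpow (by linarith)]
    simp [spectralIntegral]
  have ht' : 0 < |t| := abs_pos.2 ht
  set g : ℝ → ℝ := fun ξ => (1 - Real.cos (2 * Real.pi * (1 * ξ))) * |ξ| ^ (-1 - 2 * H) with hg
  have h1 : spectralIntegral H t = ∫ ξ : ℝ, |t| ^ (1 + 2 * H) * g (t * ξ) := by
    unfold spectralIntegral
    congr 1
    ext ξ
    have e : |t| ^ (1 + 2 * H) * |t| ^ (-1 - 2 * H) = 1 := by
      rw [← Real.rpow_add ht']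
      norm_num
    rw [hg]
    simp only [one_mul]
    rw [abs_mul, Real.mul_rpow ht'.le (abs_nonneg ξ)]
    linear_combination (-(1 - Real.cos (2 * Real.pi * (t * ξ))) * |ξ| ^ (-1 - 2 * H)) * e
  rw [h1, integral_const_mul, Measure.integral_comp_mul_left g t, smul_eq_mul, ← mul_assoc,
    abs_inv, Real.rpow_add ht', Real.rpow_one]
  have : |t| * |t| ^ (2 * H) * |t|⁻¹ = |t| ^ (2 * H) := by field_simp
  rw [this]
  rfl

theorem spectralIntegral_one_pos (hH0 : 0 < H) (hH1 : H < 1) : 0 < spectralIntegral H 1 := by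
  unfold spectralIntegral
  rw [integral_pos_iff_support_of_nonneg (fun ξ => mul_nonneg
    (sub_nonneg.2 (Real.cos_le_one _)) (Real.rpow_nonneg (abs_nonneg _) _))
    (integrable_spectral hH0 hH1 1)]
  refine lt_of_lt_of_le (b := volume (Ioo (0 : ℝ) 1)) (by simp) (measure_mono fun ξ hξ => ?_)
  have hpi := Real.pi_pos
  have h1 : 0 < 2 * Real.pi * (1 * ξ) := by have := hξ.1; positivity
  have h2 : 2 * Real.pi * (1 * ξ) < 2 * Real.pi := by
    have := hξ.2
    nlinarith
  refine mul_ne_zero (fun h => ?_) (Real.rpow_pos_of_pos (abs_pos.2 hξ.1.ne') _).ne'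
  have := (Real.cos_eq_one_iff_of_lt_of_lt (by linarith) h2).1 (sub_eq_zero.1 h).symm
  linarith

/-- The function `κ (e^{2π i t ξ} - 1) |ξ|^{-H-1/2}` of the frequency `ξ`, which represents `B_t` in
the spectral domain. -/
noncomputable def spectralFun (H t ξ : ℝ) : ℂ :=
  ((Real.sqrt (2 * spectralIntegral H 1))⁻¹ * |ξ| ^ (-H - 1 / 2) : ℝ) *
    (Complex.exp ((2 * Real.pi * (t * ξ) : ℝ) * Complex.I) - 1)

theorem inner_spectralFun (hH0 : 0 < H) (hH1 : H < 1) (s t ξ : ℝ) :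
    inner ℝ (spectralFun H s ξ) (spectralFun H t ξ) = (2 * spectralIntegral H 1)⁻¹ *
      ((1 - Real.cos (2 * Real.pi * (s * ξ))) * |ξ| ^ (-1 - 2 * H)
        + (1 - Real.cos (2 * Real.pi * (t * ξ))) * |ξ| ^ (-1 - 2 * H)
        - (1 - Real.cos (2 * Real.pi * ((s - t) * ξ))) * |ξ| ^ (-1 - 2 * H)) := by
  have hJ := spectralIntegral_one_pos hH0 hH1
  have e1 : (Real.sqrt (2 * spectralIntegral H 1))⁻¹ ^ 2 = (2 * spectralIntegral H 1)⁻¹ := by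
    rw [inv_pow, Real.sq_sqrt (by positivity)]
  have e2 : (|ξ| ^ (-H - 1 / 2)) ^ 2 = |ξ| ^ (-1 - 2 * H) := by
    rw [← Real.rpow_natCast, ← Real.rpow_mul (abs_nonneg ξ)]
    congr 1
    push_cast
    ring
  have e3 : 2 * Real.pi * ((s - t) * ξ) = 2 * Real.pi * (s * ξ) - 2 * Real.pi * (t * ξ) := by ring
  rw [Complex.inner, e3, Real.cos_sub, ← e1, ← e2]
  simp only [spectralFun, Complex.mul_re, Complex.mul_im, Complex.conj_re, Complex.conj_im,
    Complex.ofReal_re, Complex.ofReal_im, Complex.sub_re, Complex.sub_im,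
    Complex.exp_ofReal_mul_I_re, Complex.exp_ofReal_mul_I_im, Complex.one_re, Complex.one_im]
  ring

theorem measurable_spectralFun (t : ℝ) : Measurable (spectralFun H t) := by
  unfold spectralFun
  fun_prop

theorem memLp_spectralFun (hH0 : 0 < H) (hH1 : H < 1) (t : ℝ) :
    MemLp (spectralFun H t) 2 volume := by
  rw [memLp_two_iff_integrable_sq_norm (measurable_spectralFun t).aestronglyMeasurable]
  simp only [← real_inner_self_eq_norm_sq, inner_spectralFun hH0 hH1]
  have h := integrable_spectral hH0 hH1
  exact (((h t).add (h t)).sub (h (t - t))).const_mul _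

/-- The element of `L²(ℝ, ℂ)` that represents `B_t` in the spectral domain. -/
noncomputable def spectralVec (hH0 : 0 < H) (hH1 : H < 1) (t : ℝ) : Lp ℂ 2 (volume : Measure ℝ) :=
  (memLp_spectralFun hH0 hH1 t).toLp _

theorem inner_spectralVec (hH0 : 0 < H) (hH1 : H < 1) {s t : ℝ} (hs : 0 ≤ s) (ht : 0 ≤ t) :
    inner ℝ (spectralVec hH0 hH1 s) (spectralVec hH0 hH1 t) = cov H s t := by
  have hJ := spectralIntegral_one_pos hH0 hH1
  have h := integrable_spectral hH0 hH1
  have e : inner ℝ (spectralVec hH0 hH1 s) (spectralVec hH0 hH1 t)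
      = ∫ ξ, inner ℝ (spectralFun H s ξ) (spectralFun H t ξ) := by
    rw [L2.inner_def]
    refine integral_congr_ae ?_
    filter_upwards [(memLp_spectralFun hH0 hH1 s).coeFn_toLp,
      (memLp_spectralFun hH0 hH1 t).coeFn_toLp] with ξ h1 h2
    rw [spectralVec, spectralVec, h1, h2]
  rw [e]
  simp only [inner_spectralFun hH0 hH1]
  rw [integral_const_mul, integral_sub (by exact (h s).add (h t)) (h (s - t)),
    integral_add (h s) (h t)]
  change _ * (spectralIntegral H s + spectralIntegral H t - spectralIntegral H (s - t)) = _
  rw [spectralIntegral_eq hH0 s, spectralIntegral_eq hH0 t, spectralIntegral_eq hH0 (s - t),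
    abs_of_nonneg hs, abs_of_nonneg ht, cov]
  field_simp

/-- A real function on the line, supported in `[0, 2]`, twice differentiable, and bounded by `A`
together with its first two derivatives. -/
structure IsBumpPath (A : ℝ) (g : ℝ → ℝ) : Prop where
  differentiable : Differentiable ℝ g
  differentiable_deriv : Differentiable ℝ (deriv g)
  eq_zero : ∀ t, t ∉ Icc (0 : ℝ) 2 → g t = 0
  bound : ∀ t, |g t| ≤ A
  bound_deriv : ∀ t, |deriv g t| ≤ A
  bound_deriv2 : ∀ t, |deriv (deriv g) t| ≤ A

theorem deriv_eq_zero_of_eq_zero {g : ℝ → ℝ} {s : Set ℝ} (hs : IsClosed s)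
    (hg : ∀ t, t ∉ s → g t = 0) : ∀ t, t ∉ s → deriv g t = 0 := by
  intro t ht
  have : g =ᶠ[nhds t] fun _ => 0 := by
    filter_upwards [hs.isOpen_compl.mem_nhds ht] with y hy using hg y hy
  rw [this.deriv_eq, deriv_const]

theorem integrable_of_bounded_support {g : ℝ → ℝ} {A : ℝ} (hm : Measurable g)
    (h0 : ∀ t, t ∉ Icc (0 : ℝ) 2 → g t = 0) (hb : ∀ t, |g t| ≤ A) :
    Integrable g ∧ ∫ t, |g t| ≤ 2 * A := by
  have hle : ∀ t, |g t| ≤ (Icc (0 : ℝ) 2).indicator (fun _ => A) t := by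
    intro t
    by_cases ht : t ∈ Icc (0 : ℝ) 2
    · rw [indicator_of_mem ht]; exact hb t
    · rw [indicator_of_notMem ht, h0 t ht, abs_zero]
  have hi : Integrable ((Icc (0 : ℝ) 2).indicator fun _ => A) := by
    rw [integrable_indicator_iff measurableSet_Icc]
    simp
  have hg : Integrable g := hi.mono' hm.aestronglyMeasurable (Filter.Eventually.of_forall hle)
  refine ⟨hg, (integral_mono hg.abs hi hle).trans_eq ?_⟩
  rw [integral_indicator measurableSet_Icc]
  simp

theorem continuous_fourier {f : ℝ → ℂ} (hf : Integrable f) : Continuous (𝓕 f) :=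
  VectorFourier.fourierIntegral_continuous Real.continuous_fourierChar
    (innerSL ℝ).continuous₂ hf

theorem norm_fourier_le {f : ℝ → ℂ} (ξ : ℝ) : ‖𝓕 f ξ‖ ≤ ∫ t, ‖f t‖ :=
  VectorFourier.norm_fourierIntegral_le_integral_norm _ _ _ _ _

variable {A : ℝ} {g : ℝ → ℝ}

namespace IsBumpPath

theorem integrable (hg : IsBumpPath A g) : Integrable fun t => (g t : ℂ) :=
  (integrable_of_bounded_support hg.differentiable.continuous.measurable hg.eq_zero
    hg.bound).1.ofReal

theorem norm_fourier_mul_le (hg : IsBumpPath A g) (ξ : ℝ) :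
    ‖𝓕 (fun t => (g t : ℂ)) ξ‖ * (1 + |ξ|) ^ 2 ≤ 8 * A := by
  set f : ℝ → ℂ := fun t => (g t : ℂ) with hf
  have hz1 := deriv_eq_zero_of_eq_zero isClosed_Icc hg.eq_zero
  have hz2 := deriv_eq_zero_of_eq_zero isClosed_Icc hz1
  obtain ⟨i0, b0⟩ := integrable_of_bounded_support hg.differentiable.continuous.measurable
    hg.eq_zero hg.bound
  obtain ⟨i1, -⟩ := integrable_of_bounded_support (measurable_deriv g) hz1 hg.bound_deriv
  obtain ⟨i2, b2⟩ := integrable_of_bounded_support (measurable_deriv _) hz2 hg.bound_deriv2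
  have d1 : deriv f = fun t => ((deriv g t : ℝ) : ℂ) :=
    funext fun t => (hg.differentiable t).hasDerivAt.ofReal_comp.deriv
  have d2 : deriv (deriv f) = fun t => ((deriv (deriv g) t : ℝ) : ℂ) := by
    rw [d1]
    exact funext fun t => (hg.differentiable_deriv t).hasDerivAt.ofReal_comp.deriv
  have D1 : Differentiable ℝ f := fun t =>
    (hg.differentiable t).hasDerivAt.ofReal_comp.differentiableAt
  have D2 : Differentiable ℝ (deriv f) := by
    rw [d1]
    exact fun t => (hg.differentiable_deriv t).hasDerivAt.ofReal_comp.differentiableAt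
  have I1 : Integrable (deriv f) := by rw [d1]; exact i1.ofReal
  have I2 : Integrable (deriv (deriv f)) := by rw [d2]; exact i2.ofReal
  have F1 := Real.fourier_deriv hg.integrable D1 I1
  have F2 := Real.fourier_deriv I1 D2 I2
  have n0 : ‖𝓕 f ξ‖ ≤ 2 * A := (norm_fourier_le ξ).trans (by simpa [hf] using b0)
  have n2 : ‖𝓕 (deriv (deriv f)) ξ‖ ≤ 2 * A :=
    (norm_fourier_le ξ).trans (by simpa [d2] using b2)
  have hexp : ‖𝓕 (deriv (deriv f)) ξ‖ = (2 * Real.pi) ^ 2 * (|ξ| ^ 2 * ‖𝓕 f ξ‖) := by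
    rw [F2, F1]
    simp only [smul_eq_mul, norm_mul, Complex.norm_I, Complex.norm_real, Real.norm_eq_abs,
      abs_of_pos Real.pi_pos, Complex.norm_ofNat]
    ring
  have hpi : 1 ≤ (2 * Real.pi) ^ 2 := by nlinarith [Real.pi_gt_three]
  have h3 : |ξ| ^ 2 * ‖𝓕 f ξ‖ ≤ 2 * A := by
    have h4 : 0 ≤ |ξ| ^ 2 * ‖𝓕 f ξ‖ := by positivity
    nlinarith
  nlinarith [sq_nonneg (|ξ| - 1), norm_nonneg (𝓕 f ξ),
    mul_nonneg (norm_nonneg (𝓕 f ξ)) (sq_nonneg (|ξ| - 1))]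

theorem integrable_fourier (hg : IsBumpPath A g) : Integrable (𝓕 fun t => (g t : ℂ)) := by
  have hi : Integrable fun ξ : ℝ => 8 * A * (1 + ‖ξ‖) ^ (-2 : ℝ) :=
    (integrable_one_add_norm (by simp)).const_mul _
  refine hi.mono' (continuous_fourier hg.integrable).aestronglyMeasurable
    (Filter.Eventually.of_forall fun ξ => ?_)
  have h0 : 0 < 1 + |ξ| := by positivity
  rw [Real.norm_eq_abs, Real.rpow_neg h0.le, ← div_eq_mul_inv, le_div_iff₀ (by positivity)]
  exact_mod_cast hg.norm_fourier_mul_le ξ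

/-- Fourier inversion, in the form in which it pairs with `spectralFun`. -/
theorem integral_fourier (hg : IsBumpPath A g) (hg0 : g 0 = 0) (t : ℝ) :
    ∫ ξ : ℝ, (Complex.exp ((2 * Real.pi * (t * ξ) : ℝ) * Complex.I) - 1)
      * 𝓕 (fun t => (g t : ℂ)) ξ = g t := by
  have hF := hg.integrable_fourier
  have hinv : ∀ s : ℝ, ∫ ξ : ℝ, Complex.exp ((2 * Real.pi * (s * ξ) : ℝ) * Complex.I)
      * 𝓕 (fun t => (g t : ℂ)) ξ = g s := by
    intro s
    have hc : Continuous fun t => (g t : ℂ) :=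
      Complex.continuous_ofReal.comp hg.differentiable.continuous
    have h' := congrFun (hc.fourierInv_fourier_eq hg.integrable hF) s
    rw [Real.fourierInv_eq'] at h'
    simpa using h'
  have hint : ∀ s : ℝ, Integrable fun ξ : ℝ =>
      Complex.exp ((2 * Real.pi * (s * ξ) : ℝ) * Complex.I) * 𝓕 (fun t => (g t : ℂ)) ξ := by
    intro s
    refine hF.bdd_mul (c := 1) (by fun_prop) (Filter.Eventually.of_forall fun ξ => ?_)
    rw [Complex.norm_exp_ofReal_mul_I]
  have h0 := hinv 0
  simp only [zero_mul, mul_zero, Complex.ofReal_zero, Complex.exp_zero, one_mul, hg0] at h0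
  simp only [sub_mul, one_mul]
  rw [integral_sub (hint t) hF, hinv, h0, sub_zero]

end IsBumpPath

/-- A function as in `IsBumpPath` that vanishes at `0` is given by pairing the vectors `spectralVec`
with a vector of controlled norm: this is what puts smooth paths in the Cameron--Martin space. -/
theorem exists_spectral_representer (hH0 : 0 < H) (hH1 : H < 1) :
    ∃ C > 0, ∀ (A : ℝ) (g : ℝ → ℝ), IsBumpPath A g → g 0 = 0 →
      ∃ w : Lp ℂ 2 (volume : Measure ℝ),
        (∀ t, inner ℝ (spectralVec hH0 hH1 t) w = g t) ∧ ‖w‖ ≤ C * A := by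
  set κ := Real.sqrt (2 * spectralIntegral H 1) with hκ
  have hκ0 : 0 < κ := Real.sqrt_pos.2 (by have := spectralIntegral_one_pos hH0 hH1; positivity)
  set R := ∫ ξ : ℝ, (1 + ‖ξ‖) ^ (-(3 - 2 * H)) with hR
  have hRi : Integrable fun ξ : ℝ => (1 + ‖ξ‖) ^ (-(3 - 2 * H)) :=
    integrable_one_add_norm (by simp; linarith)
  have hR0 : 0 ≤ R := integral_nonneg fun ξ => by positivity
  refine ⟨κ * 8 * Real.sqrt R + 1, by positivity, fun A g hg hg0 => ?_⟩
  have hA0 : 0 ≤ A := (abs_nonneg _).trans (hg.bound 0)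
  set G := 𝓕 (fun t => (g t : ℂ)) with hG
  set W : ℝ → ℂ := fun ξ => (κ * |ξ| ^ (H + 1 / 2) : ℝ) * (starRingEnd ℂ) (G ξ) with hW
  have hWm : AEStronglyMeasurable W volume := by
    have := (continuous_fourier hg.integrable).measurable
    refine Measurable.aestronglyMeasurable ?_
    refine Measurable.mul (by fun_prop) ?_
    exact Complex.continuous_conj.measurable.comp this
  have hWb : ∀ ξ, ‖W ξ‖ ^ 2 ≤ (κ * 8 * A) ^ 2 * (1 + ‖ξ‖) ^ (-(3 - 2 * H)) := by
    intro ξ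
    have h0 : 0 < 1 + |ξ| := by positivity
    have e1 : (|ξ| ^ (H + 1 / 2)) ^ 2 ≤ (1 + |ξ|) ^ (1 + 2 * H) := by
      rw [← Real.rpow_natCast, ← Real.rpow_mul (abs_nonneg ξ)]
      have : (H + 1 / 2) * (2 : ℕ) = 1 + 2 * H := by push_cast; ring
      rw [this]
      exact Real.rpow_le_rpow (abs_nonneg _) (by linarith) (by linarith)
    have e2 : ‖G ξ‖ ≤ 8 * A * ((1 + |ξ|) ^ 2)⁻¹ := by
      rw [← div_eq_mul_inv, le_div_iff₀ (by positivity)]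
      exact hg.norm_fourier_mul_le ξ
    have e3 : (1 + |ξ|) ^ (1 + 2 * H) * (((1 + |ξ|) ^ 2)⁻¹) ^ 2 = (1 + |ξ|) ^ (-(3 - 2 * H)) := by
      have : (((1 + |ξ|) ^ 2)⁻¹) ^ 2 = (1 + |ξ|) ^ (-4 : ℝ) := by
        rw [Real.rpow_neg h0.le, inv_pow, ← pow_mul]
        norm_num
      rw [this, ← Real.rpow_add h0]
      congr 1
      ring
    have e4 : ‖W ξ‖ = κ * |ξ| ^ (H + 1 / 2) * ‖G ξ‖ := by
      rw [hW, norm_mul, Complex.norm_real, Real.norm_of_nonneg (by positivity), RCLike.norm_conj]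
    rw [e4, Real.norm_eq_abs, ← e3]
    calc (κ * |ξ| ^ (H + 1 / 2) * ‖G ξ‖) ^ 2
        = κ ^ 2 * (|ξ| ^ (H + 1 / 2)) ^ 2 * ‖G ξ‖ ^ 2 := by ring
      _ ≤ κ ^ 2 * (1 + |ξ|) ^ (1 + 2 * H) * (8 * A * ((1 + |ξ|) ^ 2)⁻¹) ^ 2 := by gcongr
      _ = _ := by ring
  have hWi : Integrable fun ξ => ‖W ξ‖ ^ 2 :=
    (hRi.const_mul _).mono' (hWm.norm.pow 2) (Filter.Eventually.of_forall fun ξ => by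
      rw [Real.norm_of_nonneg (by positivity)]
      exact hWb ξ)
  have hWL : MemLp W 2 volume := (memLp_two_iff_integrable_sq_norm hWm).2 hWi
  refine ⟨hWL.toLp _, fun t => ?_, ?_⟩
  · have h1 : inner ℝ (spectralVec hH0 hH1 t) (hWL.toLp W) =
        ∫ ξ : ℝ, ((Complex.exp ((2 * Real.pi * (t * ξ) : ℝ) * Complex.I) - 1) * G ξ).re := by
      rw [L2.inner_def]
      refine integral_congr_ae ?_
      filter_upwards [(memLp_spectralFun hH0 hH1 t).coeFn_toLp, hWL.coeFn_toLp,
        compl_mem_ae_iff.2 (measure_singleton (μ := (volume : Measure ℝ)) 0)] with ξ h1 h2 h3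
      have hξ : 0 < |ξ| := abs_pos.2 h3
      have e : κ⁻¹ * |ξ| ^ (-H - 1 / 2) * (κ * |ξ| ^ (H + 1 / 2)) = 1 := by
        have : |ξ| ^ (-H - 1 / 2) * |ξ| ^ (H + 1 / 2) = 1 := by
          rw [← Real.rpow_add hξ]; norm_num
        calc _ = κ⁻¹ * κ * (|ξ| ^ (-H - 1 / 2) * |ξ| ^ (H + 1 / 2)) := by ring
          _ = 1 := by rw [this, inv_mul_cancel₀ hκ0.ne', one_mul]
      rw [spectralVec, h1, h2, Complex.inner, hW]
      simp only [spectralFun, ← hκ, Complex.mul_re, Complex.mul_im, Complex.conj_re,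
        Complex.conj_im, Complex.ofReal_re, Complex.ofReal_im]
      linear_combination ((Complex.exp ((2 * Real.pi * (t * ξ) : ℝ) * Complex.I) - 1).re * (G ξ).re
        - (Complex.exp ((2 * Real.pi * (t * ξ) : ℝ) * Complex.I) - 1).im * (G ξ).im) * e
    have hint : Integrable fun ξ : ℝ =>
        (Complex.exp ((2 * Real.pi * (t * ξ) : ℝ) * Complex.I) - 1) * G ξ := by
      refine hg.integrable_fourier.bdd_mul (c := 2) (by fun_prop)
        (Filter.Eventually.of_forall fun ξ => ?_)
      refine (norm_sub_le _ _).trans ?_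
      rw [Complex.norm_exp_ofReal_mul_I, norm_one]
      norm_num
    rw [h1]
    have := integral_re hint
    simp only [RCLike.re_to_complex] at this
    rw [this, hg.integral_fourier hg0, Complex.ofReal_re]
  · have h1 : ‖hWL.toLp W‖ ^ 2 = ∫ ξ, ‖W ξ‖ ^ 2 := by
      rw [← real_inner_self_eq_norm_sq, L2.inner_def]
      refine integral_congr_ae ?_
      filter_upwards [hWL.coeFn_toLp] with ξ h
      rw [h, real_inner_self_eq_norm_sq]
    have h2 : ‖hWL.toLp W‖ ^ 2 ≤ (κ * 8 * Real.sqrt R * A) ^ 2 := by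
      rw [h1]
      refine (integral_mono hWi (hRi.const_mul _) hWb).trans_eq ?_
      rw [integral_const_mul, ← hR]
      linear_combination (-(κ * 8 * A) ^ 2) * Real.sq_sqrt hR0
    have h3 := abs_le_of_sq_le_sq' h2 (by positivity) |>.2
    linarith

end Spectral

/-! ### Families of vectors with the same Gram matrix -/

section GramTransfer

variable {E F : Type*} [NormedAddCommGroup E] [InnerProductSpace ℝ E] [CompleteSpace E]
  [NormedAddCommGroup F] [InnerProductSpace ℝ F]

/-- Two families of vectors with the same Gram matrix span isometric subspaces, so every functional
on one of them given by a vector is represented in the closed span of the other. -/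
theorem exists_representer_of_gram_eq {ι : Type*} {b : ι → E} {e : ι → F}
    (hbe : ∀ i j, inner ℝ (b i) (b j) = inner ℝ (e i) (e j)) (w : F) :
    ∃ Z ∈ (Submodule.span ℝ (range b)).topologicalClosure,
      (∀ i, inner ℝ (b i) Z = inner ℝ (e i) w) ∧ ‖Z‖ ≤ ‖w‖ := by
  set T := Finsupp.linearCombination ℝ b with hT
  set S := Finsupp.linearCombination ℝ e with hS
  have hnorm : ∀ a, ‖T a‖ = ‖S a‖ := by
    intro a
    have h : ‖T a‖ ^ 2 = ‖S a‖ ^ 2 := by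
      rw [← real_inner_self_eq_norm_sq, ← real_inner_self_eq_norm_sq, hT, hS,
        Finsupp.linearCombination_apply, Finsupp.linearCombination_apply, Finsupp.sum_inner,
        Finsupp.sum_inner]
      simp only [Finsupp.sum, inner_sum, real_inner_smul_left, real_inner_smul_right, hbe]
    exact (sq_eq_sq₀ (norm_nonneg _) (norm_nonneg _)).1 h
  obtain ⟨R, hR⟩ := T.rangeRestrict.exists_rightInverse_of_surjective T.range_rangeRestrict
  have hTR : ∀ m : T.range, T (R m) = m := fun m => by
    have := congrArg Subtype.val (LinearMap.congr_fun hR m)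
    simpa using this
  let φ : T.range →L[ℝ] ℝ :=
    ((innerSL ℝ w).toLinearMap ∘ₗ S ∘ₗ R).mkContinuous ‖w‖ fun m => by
      have h1 := norm_inner_le_norm (𝕜 := ℝ) w (S (R m))
      rw [← hnorm, hTR] at h1
      simpa using h1
  have hφ : ‖φ‖ ≤ ‖w‖ := LinearMap.mkContinuous_norm_le _ (norm_nonneg _) _
  have hbmem : ∀ i, b i ∈ T.range := fun i => ⟨Finsupp.single i 1, by simp [hT]⟩
  have hφb : ∀ i, φ ⟨b i, hbmem i⟩ = inner ℝ (e i) w := by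
    intro i
    have h0 : ‖S (R ⟨b i, hbmem i⟩ - Finsupp.single i 1)‖ = 0 := by
      rw [← hnorm, map_sub, hTR]
      simp [hT]
    rw [norm_eq_zero, map_sub, sub_eq_zero] at h0
    have h1 : S (Finsupp.single i 1) = e i := by simp [hS]
    change inner ℝ w (S (R ⟨b i, hbmem i⟩)) = _
    rw [h0, h1, real_inner_comm]
  obtain ⟨g, hg, hgn⟩ := exists_extension_norm_eq T.range φ
  set K := (Submodule.span ℝ (range b)).topologicalClosure with hK
  set Z₀ := (InnerProductSpace.toDual ℝ E).symm g with hZ₀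
  refine ⟨K.starProjection Z₀, Submodule.starProjection_apply_mem _ _, fun i => ?_, ?_⟩
  · have hbK : b i ∈ K := Submodule.le_topologicalClosure _ (Submodule.subset_span ⟨i, rfl⟩)
    rw [← Submodule.inner_starProjection_left_eq_right, Submodule.starProjection_eq_self_iff.2 hbK,
      real_inner_comm, hZ₀, InnerProductSpace.toDual_symm_apply, ← hφb i]
    exact hg ⟨b i, hbmem i⟩
  · refine (K.norm_starProjection_apply_le Z₀).trans ?_
    rw [hZ₀, LinearIsometryEquiv.norm_map, hgn]
    exact hφ

end GramTransfer

/-! ### Smooth Cameron--Martin paths -/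

theorem exists_represents {H : ℝ} (hH0 : 0 < H) (hH1 : H < 1) (d : ℕ) :
    ∃ C > 0, ∀ {Ω : Type*} [MeasurableSpace Ω] (P : Measure Ω)
      (B : I → Ω → EuclideanSpace ℝ (Fin d)), IsFractionalBrownianMotion P H B →
      ∀ (A : ℝ) (h : C(I, EuclideanSpace ℝ (Fin d))) (g : Fin d → ℝ → ℝ),
        (∀ i, IsBumpPath A (g i)) → (∀ i, g i 0 = 0) → (∀ t i, h t i = g i t) → 0 ≤ A →
        ∃ Z, Represents P B Z h ∧ ‖Z‖ ≤ C * A := by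
  obtain ⟨C, hC, HC⟩ := exists_spectral_representer hH0 hH1
  refine ⟨(d + 1) * C, by positivity, fun {Ω} _ P B hB A h g hg hg0 hh hA => ?_⟩
  have hrep : ∀ i, ∃ Z ∈ (Submodule.span ℝ (range fun t => hB.evalLp t i)).topologicalClosure,
      (∀ t, inner ℝ (hB.evalLp t i) Z = g i t) ∧ ‖Z‖ ≤ C * A := by
    intro i
    obtain ⟨w, hw, hwn⟩ := HC A (g i) (hg i) (hg0 i)
    obtain ⟨Z, hZ, hZw, hZn⟩ := exists_representer_of_gram_eq (b := fun t : I => hB.evalLp t i)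
      (e := fun t : I => spectralVec hH0 hH1 t)
      (fun s t => by
        rw [hB.inner_evalLp_evalLp, if_pos rfl, inner_spectralVec hH0 hH1 s.2.1 t.2.1]) w
    exact ⟨Z, hZ, fun t => (hZw t).trans (hw t), hZn.trans hwn⟩
  choose Z hZmem hZg hZn using hrep
  have horth : ∀ t i j, i ≠ j → inner ℝ (hB.evalLp t i) (Z j) = 0 := by
    intro t i j hij
    have hle : (Submodule.span ℝ (range fun s => hB.evalLp s j)).topologicalClosure ≤
        (Submodule.span ℝ {hB.evalLp t i})ᗮ := by
      refine Submodule.topologicalClosure_minimal _ (Submodule.span_le.2 ?_)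
        (Submodule.isClosed_orthogonal _)
      rintro _ ⟨s, rfl⟩
      refine Submodule.mem_orthogonal_singleton_iff_inner_right.2 ?_
      change inner ℝ (hB.evalLp t i) (hB.evalLp s j) = 0
      rw [hB.inner_evalLp_evalLp, if_neg hij]
    exact Submodule.mem_orthogonal_singleton_iff_inner_right.1 (hle (hZmem j))
  refine ⟨∑ i, Z i, ⟨?_, fun t i => ?_⟩, ?_⟩
  · rw [hB.firstChaos_eq]
    refine Submodule.sum_mem _ fun i _ => ?_
    refine Submodule.topologicalClosure_mono (Submodule.span_mono ?_) (hZmem i)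
    rintro _ ⟨t, rfl⟩
    exact ⟨(t, i), rfl⟩
  · rw [← hB.inner_evalLp, inner_sum, Finset.sum_eq_single i (fun j _ hj => horth t i j hj.symm)
      (by simp), hZg, hh]
  · refine (norm_sum_le_of_le _ fun i _ => hZn i).trans ?_
    simp only [Finset.sum_const, Finset.card_univ, Fintype.card_fin, nsmul_eq_mul]
    have : 0 ≤ C * A := by positivity
    linarith

/-! ### Classical solutions and the right inverse of the fields -/

section Classical

variable {N d : ℕ} {V : Fin d → EuclideanSpace ℝ (Fin N) → EuclideanSpace ℝ (Fin N)}

theorem hasFiniteVariation_one {E : Type*} [NormedAddCommGroup E] {f : I → E} {C : ℝ}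
    (hC : 0 ≤ C) (hf : ∀ s t : I, s ≤ t → ‖f t - f s‖ ≤ C * ((t : ℝ) - s)) :
    HasFiniteVariation 1 f := by
  refine ⟨C, fun n u hu => ?_⟩
  calc ∑ i ∈ Finset.range n, ‖f (u (i + 1)) - f (u i)‖ ^ (1 : ℝ)
      ≤ ∑ i ∈ Finset.range n, C * ((u (i + 1) : ℝ) - u i) := Finset.sum_le_sum fun i _ => by
        rw [Real.rpow_one]; exact hf _ _ (hu (Nat.le_succ i))
    _ = C * ((u n : ℝ) - u 0) := by
        rw [← Finset.mul_sum, Finset.sum_range_sub fun i => (u i : ℝ)]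
    _ ≤ C := mul_le_of_le_one_right hC (by linarith [(u n).2.2, (u 0).2.1])

/-- A classical solution with bounded derivatives is a Young solution. -/
theorem isYoungSolution_of_hasDerivAt {L R R' : ℝ} (hL0 : 0 ≤ L)
    (hL : ∀ y z, ‖fieldMap V y - fieldMap V z‖ ≤ L * ‖y - z‖)
    {f f' : ℝ → EuclideanSpace ℝ (Fin d)} {Y Y' : ℝ → EuclideanSpace ℝ (Fin N)}
    (hf : ∀ t, HasDerivAt f (f' t) t) (hY : ∀ t, HasDerivAt Y (Y' t) t)
    (heq : ∀ t, Y' t = fieldMap V (Y t) (f' t)) (hR : ∀ t, ‖f' t‖ ≤ R) (hR' : ∀ t, ‖Y' t‖ ≤ R')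
    {h : C(I, EuclideanSpace ℝ (Fin d))} {X : C(I, EuclideanSpace ℝ (Fin N))}
    (hh : ∀ t, h t = f t) (hX : ∀ t, X t = Y t) : IsYoungSolution V h (Y 0) X := by
  have hR0 : 0 ≤ R := (norm_nonneg _).trans (hR 0)
  have hR0' : 0 ≤ R' := (norm_nonneg _).trans (hR' 0)
  have lipf : ∀ s t, ‖f t - f s‖ ≤ R * ‖t - s‖ := fun s t =>
    convex_univ.norm_image_sub_le_of_norm_hasDerivWithin_le
      (fun t _ => (hf t).hasDerivWithinAt) (fun t _ => hR t) (mem_univ s) (mem_univ t)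
  have lipY : ∀ s t, ‖Y t - Y s‖ ≤ R' * ‖t - s‖ := fun s t =>
    convex_univ.norm_image_sub_le_of_norm_hasDerivWithin_le
      (fun t _ => (hY t).hasDerivWithinAt) (fun t _ => hR' t) (mem_univ s) (mem_univ t)
  refine ⟨⟨1, le_rfl, by norm_num, hasFiniteVariation_one hR0 fun s t hst => ?_,
    hasFiniteVariation_one hR0' fun s t hst => ?_⟩, fun t ε hε => ?_⟩
  · have := lipf s t
    rwa [Real.norm_of_nonneg (sub_nonneg.2 (show (s : ℝ) ≤ t from hst)), ← hh, ← hh] at this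
  · have := lipY s t
    rwa [Real.norm_of_nonneg (sub_nonneg.2 (show (s : ℝ) ≤ t from hst)), ← hX, ← hX] at this
  set C := L * R' * R with hC
  have hC0 : 0 ≤ C := by positivity
  refine ⟨ε / (C + 1), by positivity, fun n u τ hu hu0 hun hδ hτ => ?_⟩
  set δ := ε / (C + 1) with hδdef
  have hδ0 : 0 < δ := by positivity
  have hCδ : C * δ ≤ ε := by
    rw [hδdef, mul_div_assoc', div_le_iff₀ (by positivity)]
    nlinarith
  have htel : X t - Y 0 = ∑ i ∈ Finset.range n, (Y (u (i + 1)) - Y (u i)) := by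
    rw [Finset.sum_range_sub fun i => Y (u i), hun, hu0, hX]
    rfl
  have hterm : ∀ i, ∑ α : Fin d, (h (u (i + 1)) α - h (u i) α) • V α (X (τ i))
      = fieldMap V (Y (τ i)) (f (u (i + 1)) - f (u i)) := fun i => by
    simp [fieldMap_apply, hh, hX]
  rw [htel, ← Finset.sum_sub_distrib]
  simp only [hterm]
  have hbound : ∀ i ∈ Finset.range n, ‖fieldMap V (Y (τ i)) (f (u (i + 1)) - f (u i))
      - (Y (u (i + 1)) - Y (u i))‖ ≤ C * δ * ((u (i + 1) : ℝ) - u i) := by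
    intro i hi
    have hi' := Finset.mem_range.1 hi
    have hle : (u i : ℝ) ≤ u (i + 1) := hu (Nat.le_succ i)
    have hτ1 : (u i : ℝ) ≤ τ i := (hτ i hi').1
    have hτ2 : (τ i : ℝ) ≤ u (i + 1) := (hτ i hi').2
    have hstep := hδ i hi'
    -- mean value inequality for `t ↦ V(Y_τ) f_t - Y_t` between two points of the partition
    have hder : ∀ r ∈ Icc (u i : ℝ) (u (i + 1)), HasDerivWithinAt
        (fun r => fieldMap V (Y (τ i)) (f r) - Y r)
        ((fieldMap V (Y (τ i)) - fieldMap V (Y r)) (f' r)) (Icc (u i : ℝ) (u (i + 1))) r := by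
      intro r _
      have h1 := ((fieldMap V (Y (τ i))).hasFDerivAt.comp_hasDerivAt r (hf r)).sub (hY r)
      rw [heq r] at h1
      exact h1.hasDerivWithinAt
    have hnb : ∀ r ∈ Icc (u i : ℝ) (u (i + 1)),
        ‖(fieldMap V (Y (τ i)) - fieldMap V (Y r)) (f' r)‖ ≤ C * δ := by
      intro r hr
      refine (ContinuousLinearMap.le_opNorm _ _).trans ?_
      have h1 : ‖Y (τ i) - Y r‖ ≤ R' * δ := by
        refine (lipY r (τ i)).trans (mul_le_mul_of_nonneg_left ?_ hR0')
        rw [Real.norm_eq_abs, abs_le]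
        constructor <;> linarith [hr.1, hr.2]
      calc _ ≤ L * (R' * δ) * R := by
            refine mul_le_mul ((hL _ _).trans ?_) (hR r) (norm_nonneg _) (by positivity)
            gcongr
        _ = C * δ := by rw [hC]; ring
    have := (convex_Icc (u i : ℝ) (u (i + 1))).norm_image_sub_le_of_norm_hasDerivWithin_le hder hnb
      (left_mem_Icc.2 hle) (right_mem_Icc.2 hle)
    rw [Real.norm_of_nonneg (sub_nonneg.2 hle)] at this
    refine le_trans (le_of_eq ?_) this
    rw [map_sub]
    congr 1
    abel
  refine (norm_sum_le_of_le _ hbound).trans ?_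
  rw [← Finset.mul_sum, Finset.sum_range_sub fun i => (u i : ℝ)]
  refine le_trans ?_ hCδ
  exact mul_le_of_le_one_right (by positivity) (by linarith [(u n).2.2, (u 0).2.1])

end Classical

section RightInverse

variable {E F : Type*} [NormedAddCommGroup E] [InnerProductSpace ℝ E] [CompleteSpace E]
  [NormedAddCommGroup F] [InnerProductSpace ℝ F] [CompleteSpace F]

/-- The adjoint of real operators as a linear, rather than conjugate-linear, map. -/
noncomputable def adjointCLM : (E →L[ℝ] F) →L[ℝ] (F →L[ℝ] E) :=
  LinearMap.mkContinuous
    { toFun := fun T => ContinuousLinearMap.adjoint T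
      map_add' := fun S T => map_add _ S T
      map_smul' := fun c T => by simp } 1 fun T => by simp

theorem adjointCLM_apply (T : E →L[ℝ] F) : adjointCLM T = ContinuousLinearMap.adjoint T := rfl

theorem norm_adjointCLM_apply (T : E →L[ℝ] F) : ‖adjointCLM T‖ = ‖T‖ := by
  rw [adjointCLM_apply, LinearIsometryEquiv.norm_map]

variable [FiniteDimensional ℝ F]

theorem isUnit_comp_adjoint {Λ : ℝ} (hΛ : 0 < Λ) {T : E →L[ℝ] F}
    (hT : ∀ ξ, Λ * ‖ξ‖ ^ 2 ≤ ‖adjointCLM T ξ‖ ^ 2) :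
    IsUnit (T ∘L adjointCLM T) ∧ ‖Ring.inverse (T ∘L adjointCLM T)‖ ≤ Λ⁻¹ := by
  set a := T ∘L adjointCLM T with ha
  have hlow : ∀ ξ, Λ * ‖ξ‖ ≤ ‖a ξ‖ := by
    intro ξ
    have h1 : inner ℝ ξ (a ξ) = ‖adjointCLM T ξ‖ ^ 2 := by
      rw [← real_inner_self_eq_norm_sq, ha, ContinuousLinearMap.comp_apply]
      conv_rhs => rw [adjointCLM_apply T, ContinuousLinearMap.adjoint_inner_left]
      rfl
    have h2 := real_inner_le_norm ξ (a ξ)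
    rcases (norm_nonneg ξ).eq_or_lt with h | h
    · rw [← h, mul_zero]; exact norm_nonneg _
    · have := hT ξ
      rw [h1] at h2
      nlinarith
  have hinj : Function.Injective a := by
    rw [injective_iff_map_eq_zero]
    intro ξ hξ
    have := hlow ξ
    rw [hξ, norm_zero] at this
    have h0 := norm_nonneg ξ
    exact norm_eq_zero.1 (by nlinarith)
  have hunit : IsUnit a := ContinuousLinearMap.isUnit_iff_bijective.2
    ⟨hinj, (LinearMap.injective_iff_surjective (f := a.toLinearMap)).1 hinj⟩
  refine ⟨hunit, ContinuousLinearMap.opNorm_le_bound _ (by positivity) fun η => ?_⟩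
  have h1 : a (Ring.inverse a η) = η := by
    have := congrArg (fun S : F →L[ℝ] F => S η) (Ring.mul_inverse_cancel a hunit)
    simpa using this
  have h2 := hlow (Ring.inverse a η)
  rw [h1] at h2
  rw [inv_mul_eq_div, le_div_iff₀ hΛ, mul_comm]
  exact h2

/-- Along a curve of uniformly surjective operators `G`, the solutions `q = G* (G G*)⁻¹ v` of
`G q = v` and their derivatives are bounded. -/
theorem exists_right_inverse_curve {Λ M L : ℝ} (hΛ : 0 < Λ) {G G' : ℝ → E →L[ℝ] F}
    (hG : ∀ u, HasDerivAt G (G' u) u) (hM : ∀ u, ‖G u‖ ≤ M) (hL : ∀ u, ‖G' u‖ ≤ L)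
    (hell : ∀ u ξ, Λ * ‖ξ‖ ^ 2 ≤ ‖adjointCLM (G u) ξ‖ ^ 2) (v : F) :
    ∃ q q' : ℝ → E, (∀ u, HasDerivAt q (q' u) u) ∧ (∀ u, G u (q u) = v) ∧
      (∀ u, ‖q u‖ ≤ M * Λ⁻¹ * ‖v‖) ∧
      ∀ u, ‖q' u‖ ≤ (L * Λ⁻¹ + M * (Λ⁻¹ * (2 * M * L) * Λ⁻¹)) * ‖v‖ := by
  have hM0 : 0 ≤ M := (norm_nonneg _).trans (hM 0)
  have hL0 : 0 ≤ L := (norm_nonneg _).trans (hL 0)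
  set a : ℝ → F →L[ℝ] F := fun u => G u ∘L adjointCLM (G u) with ha
  set a' : ℝ → F →L[ℝ] F := fun u => G' u ∘L adjointCLM (G u) + G u ∘L adjointCLM (G' u) with ha'
  have hadj : ∀ u, HasDerivAt (fun u => adjointCLM (G u)) (adjointCLM (G' u)) u := fun u =>
    (adjointCLM (E := E) (F := F)).hasFDerivAt.comp_hasDerivAt u (hG u)
  have hda : ∀ u, HasDerivAt a (a' u) u := fun u => (hG u).clm_comp (hadj u)
  have hunit := fun u => (isUnit_comp_adjoint hΛ (hell u)).1
  have hinv := fun u => (isUnit_comp_adjoint hΛ (hell u)).2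
  set b : ℝ → F →L[ℝ] F := fun u => Ring.inverse (a u) with hb
  set b' : ℝ → F →L[ℝ] F := fun u => -(b u * a' u * b u) with hb'
  have hdb : ∀ u, HasDerivAt b (b' u) u := by
    intro u
    obtain ⟨x, hx⟩ := hunit u
    have hxa : (x : F →L[ℝ] F) = a u := hx
    have hbx : b u = ↑x⁻¹ := by rw [hb]; simp only [← hxa, Ring.inverse_unit]
    have h1 := hasFDerivAt_ringInverse (𝕜 := ℝ) x
    rw [hxa] at h1
    have h2 := h1.comp_hasDerivAt u (hda u)
    have e : (-((ContinuousLinearMap.mulLeftRight ℝ (F →L[ℝ] F)) ↑x⁻¹) ↑x⁻¹) (a' u) = b' u := by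
      rw [hb']
      simp only [hbx]
      simp
    rw [e] at h2
    exact h2
  have ha'n : ∀ u, ‖a' u‖ ≤ 2 * M * L := by
    intro u
    have h1 := ContinuousLinearMap.opNorm_comp_le (G' u) (adjointCLM (G u))
    have h2 := ContinuousLinearMap.opNorm_comp_le (G u) (adjointCLM (G' u))
    rw [norm_adjointCLM_apply] at h1 h2
    have h3 := mul_le_mul (hL u) (hM u) (norm_nonneg _) hL0
    have h4 := mul_le_mul (hM u) (hL u) (norm_nonneg _) hM0
    have h5 := norm_add_le (G' u ∘L adjointCLM (G u)) (G u ∘L adjointCLM (G' u))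
    have : ‖a' u‖ ≤ L * M + M * L := by
      rw [ha']
      linarith
    linarith
  have hb'n : ∀ u, ‖b' u‖ ≤ Λ⁻¹ * (2 * M * L) * Λ⁻¹ := by
    intro u
    rw [hb', norm_neg]
    refine (norm_mul_le _ _).trans ?_
    refine mul_le_mul ((norm_mul_le _ _).trans ?_) (hinv u) (norm_nonneg _) (by positivity)
    exact mul_le_mul (hinv u) (ha'n u) (norm_nonneg _) (by positivity)
  have hbv : ∀ u, ‖b u v‖ ≤ Λ⁻¹ * ‖v‖ := fun u =>
    (b u).le_of_opNorm_le (hinv u) v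
  refine ⟨fun u => adjointCLM (G u) (b u v),
    fun u => adjointCLM (G' u) (b u v) + adjointCLM (G u) (b' u v), fun u => ?_, fun u => ?_,
    fun u => ?_, fun u => ?_⟩
  · have h1 : HasDerivAt (fun u => b u v) (b' u v) u := by
      simpa using (hdb u).clm_apply (hasDerivAt_const u v)
    exact (hadj u).clm_apply h1
  · have := congrArg (fun S : F →L[ℝ] F => S v) (Ring.mul_inverse_cancel (a u) (hunit u))
    exact this
  · refine ((adjointCLM (G u)).le_opNorm _).trans ?_
    rw [norm_adjointCLM_apply, mul_assoc]
    exact mul_le_mul (hM u) (hbv u) (norm_nonneg _) hM0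
  · refine (norm_add_le _ _).trans ?_
    rw [add_mul]
    refine add_le_add (((adjointCLM (G' u)).le_opNorm _).trans ?_)
      (((adjointCLM (G u)).le_opNorm _).trans ?_)
    · rw [norm_adjointCLM_apply, mul_assoc]
      exact mul_le_mul (hL u) (hbv u) (norm_nonneg _) hL0
    · rw [norm_adjointCLM_apply, mul_assoc]
      exact mul_le_mul (hM u) ((b' u).le_of_opNorm_le (hb'n u) v) (norm_nonneg _) hM0

end RightInverse

/-! ### The two bounds -/

section Bounds

variable {N d : ℕ} {V : Fin d → EuclideanSpace ℝ (Fin N) → EuclideanSpace ℝ (Fin N)}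

theorem IsCbInfty.exists_bounds (hV : IsCbInfty V) :
    ∃ M > 0, ∃ L > 0, (∀ x, ‖fieldMap V x‖ ≤ M) ∧ Differentiable ℝ (fieldMap V) ∧
      ∀ x, ‖fderiv ℝ (fieldMap V) x‖ ≤ L := by
  let T : Fin d → EuclideanSpace ℝ (Fin N) →L[ℝ]
      (EuclideanSpace ℝ (Fin d) →L[ℝ] EuclideanSpace ℝ (Fin N)) := fun α =>
    ContinuousLinearMap.smulRightL ℝ _ _ (EuclideanSpace.proj α)
  have hdiff : ∀ α, Differentiable ℝ (V α) := fun α => (hV α).1.differentiable (by simp)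
  choose m hm using fun α => (hV α).2 0
  choose l hl using fun α => (hV α).2 1
  simp only [norm_iteratedFDeriv_zero] at hm
  simp only [norm_iteratedFDeriv_one] at hl
  have hder : ∀ x, HasFDerivAt (fieldMap V) (∑ α, T α ∘L fderiv ℝ (V α) x) x := fun x =>
    HasFDerivAt.fun_sum fun α _ => (T α).hasFDerivAt.comp x (hdiff α x).hasFDerivAt
  have hm0 : ∀ α, 0 ≤ m α := fun α => (norm_nonneg _).trans (hm α 0)
  have hl0 : ∀ α, 0 ≤ l α := fun α => (norm_nonneg _).trans (hl α 0)
  refine ⟨∑ α, ‖T α‖ * m α + 1, add_pos_of_nonneg_of_pos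
      (Finset.sum_nonneg fun α _ => by have := hm0 α; positivity) one_pos,
    ∑ α, ‖T α‖ * l α + 1, add_pos_of_nonneg_of_pos
      (Finset.sum_nonneg fun α _ => by have := hl0 α; positivity) one_pos,
    fun x => ?_, fun x => (hder x).differentiableAt, fun x => ?_⟩
  · have h1 : ∀ α ∈ Finset.univ, ‖T α (V α x)‖ ≤ ‖T α‖ * m α := fun α _ =>
      ((T α).le_opNorm _).trans (mul_le_mul_of_nonneg_left (hm α x) (norm_nonneg _))
    have h2 : ‖fieldMap V x‖ ≤ ∑ α, ‖T α‖ * m α :=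
      norm_sum_le_of_le (f := fun α => T α (V α x)) _ h1
    linarith
  · rw [(hder x).fderiv]
    have h1 : ∀ α ∈ Finset.univ, ‖T α ∘L fderiv ℝ (V α) x‖ ≤ ‖T α‖ * l α := fun α _ =>
      ((T α).opNorm_comp_le _).trans (mul_le_mul_of_nonneg_left (hl α x) (norm_nonneg _))
    have h2 : ‖∑ α, T α ∘L fderiv ℝ (V α) x‖ ≤ ∑ α, ‖T α‖ * l α :=
      norm_sum_le_of_le (f := fun α => T α ∘L fderiv ℝ (V α) x) _ h1
    linarith

theorem norm_adjoint_fieldMap_sq (x ξ : EuclideanSpace ℝ (Fin N)) :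
    ‖adjointCLM (fieldMap V x) ξ‖ ^ 2 =
      ξ.ofLp ⬝ᵥ (fieldMatrix V x * (fieldMatrix V x)ᵀ) *ᵥ ξ.ofLp := by
  have hcoord : ∀ α, adjointCLM (fieldMap V x) ξ α = ((fieldMatrix V x)ᵀ *ᵥ ξ.ofLp) α := by
    intro α
    have h1 : adjointCLM (fieldMap V x) ξ α =
        inner ℝ (EuclideanSpace.single α (1 : ℝ)) (adjointCLM (fieldMap V x) ξ) := by
      rw [EuclideanSpace.inner_single_left]
      simp
    have h2 : fieldMap V x (EuclideanSpace.single α (1 : ℝ)) = V α x := by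
      rw [fieldMap_apply]
      simp
    rw [h1, adjointCLM_apply, ContinuousLinearMap.adjoint_inner_right, h2]
    simp [fieldMatrix, Matrix.mulVec, dotProduct, PiLp.inner_apply, mul_comm]
  rw [EuclideanSpace.norm_sq_eq, ← Matrix.mulVec_mulVec, Matrix.dotProduct_mulVec,
    ← Matrix.mulVec_transpose]
  simp only [hcoord, dotProduct, Real.norm_eq_abs, sq_abs]
  simp only [sq]

/-- A smooth function that goes from `0` at time `0` to `1` at time `1`, and back to `0` at time
`2`. The return makes the driving path compactly supported as a function on the line. -/
theorem exists_bump : ∃ (φ : ℝ → ℝ) (K : ℝ), 0 ≤ K ∧ Differentiable ℝ φ ∧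
    Differentiable ℝ (deriv φ) ∧ φ 0 = 0 ∧ φ 1 = 1 ∧ (∀ t, t ∉ Icc (0 : ℝ) 2 → φ t = 0) ∧
    (∀ t, φ t ∈ Icc (0 : ℝ) 1) ∧ (∀ t, |deriv φ t| ≤ K) ∧ ∀ t, |deriv (deriv φ) t| ≤ K := by
  let φ : ContDiffBump (1 : ℝ) := ⟨1 / 2, 1, by norm_num, by norm_num⟩
  have hs : ContDiff ℝ 2 φ := φ.contDiff
  have hs' : ContDiff ℝ 1 (deriv φ) := ((contDiff_succ_iff_deriv (n := 1)).1 hs).2.2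
  have hc := φ.hasCompactSupport
  obtain ⟨K₁, h₁⟩ := hc.deriv.exists_bound_of_continuous hs'.continuous
  obtain ⟨K₂, h₂⟩ := hc.deriv.deriv.exists_bound_of_continuous (hs'.continuous_deriv le_rfl)
  simp only [Real.norm_eq_abs] at h₁ h₂
  refine ⟨φ, max K₁ K₂, ((abs_nonneg _).trans (h₁ 0)).trans (le_max_left _ _),
    hs.differentiable (by simp), hs'.differentiable (by simp),
    φ.zero_of_le_dist (by simp [φ]), φ.one_of_mem_closedBall (by simp [φ]), fun t ht => ?_,
    fun t => ⟨φ.nonneg, φ.le_one⟩, fun t => (h₁ t).trans (le_max_left _ _),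
    fun t => (h₂ t).trans (le_max_right _ _)⟩
  refine φ.zero_of_le_dist ?_
  change 1 ≤ dist t 1
  rw [Real.dist_eq, le_abs']
  by_contra! h
  exact ht ⟨by linarith, by linarith⟩

/-- The straight segment from `x` to `y`, run through smoothly, is the solution driven by the
Cameron--Martin path whose velocity is the image of the velocity of the segment under the right
inverse `V* (V V*)⁻¹`. -/
theorem exists_joining_path {H : ℝ} (hH0 : 0 < H) (hH1 : H < 1) (hV : IsCbInfty V)
    (hell : IsUniformlyElliptic V) :
    ∃ C > 0, ∀ {Ω : Type*} [MeasurableSpace Ω] (P : Measure Ω)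
      (B : I → Ω → EuclideanSpace ℝ (Fin d)), IsFractionalBrownianMotion P H B →
      ∀ x y : EuclideanSpace ℝ (Fin N), ‖x - y‖ ≤ 1 →
        ∃ h ∈ joiningPaths V P B x y, cmNorm P B h ≤ C * ‖x - y‖ := by
  obtain ⟨M, hM0, L, hL0, hM, hdiff, hL⟩ := hV.exists_bounds
  obtain ⟨Λ, hΛ, _, _, hellΛ⟩ := hell
  obtain ⟨φ, K, hK0, hφ, hφ', hφ0, hφ1, hφs, hφI, hφK, hφK'⟩ := exists_bump
  obtain ⟨C, hC, HC⟩ := exists_represents hH0 hH1 d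
  set Q := M * Λ⁻¹ + (L * Λ⁻¹ + M * (Λ⁻¹ * (2 * M * L) * Λ⁻¹)) with hQ
  have hQ0 : 0 < Q := by positivity
  set D := Q * (1 + K + K ^ 2) with hD
  have hD0 : 0 < D := by positivity
  refine ⟨C * D, by positivity, fun {Ω} _ P B hB x y hxy => ?_⟩
  set v := y - x with hv
  have hvn : ‖v‖ = ‖x - y‖ := norm_sub_rev y x
  rw [← hvn] at hxy ⊢
  have hv0 := norm_nonneg v
  obtain ⟨q, q', hq, hGq, hqb, hqb'⟩ := exists_right_inverse_curve (L := L) hΛ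
    (G := fun u : ℝ => fieldMap V (x + u • v)) (G' := fun u => fderiv ℝ (fieldMap V) (x + u • v) v)
    (fun u => by
      have h1 : HasDerivAt (fun u : ℝ => x + u • v) v u := by
        simpa using ((hasDerivAt_id u).smul_const v).const_add x
      exact (hdiff (x + u • v)).hasFDerivAt.comp_hasDerivAt u h1)
    (fun u => hM _)
    (fun u => ((fderiv ℝ (fieldMap V) (x + u • v)).le_of_opNorm_le (hL _) v).trans
      (mul_le_of_le_one_right hL0.le hxy))
    (fun u ξ => by rw [norm_adjoint_fieldMap_sq]; exact (hellΛ _ ξ).1) v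
  have hqQ : ∀ u, ‖q u‖ ≤ Q * ‖v‖ := fun u => (hqb u).trans
    (mul_le_mul_of_nonneg_right (le_add_of_nonneg_right (by positivity)) hv0)
  have hqQ' : ∀ u, ‖q' u‖ ≤ Q * ‖v‖ := fun u => (hqb' u).trans
    (mul_le_mul_of_nonneg_right (le_add_of_nonneg_left (by positivity)) hv0)
  have hqc : Continuous q := continuous_iff_continuousAt.2 fun u => (hq u).continuousAt
  set Γ : ℝ → EuclideanSpace ℝ (Fin d) := fun u => ∫ s in (0 : ℝ)..u, q s with hΓ
  have hΓd : ∀ u, HasDerivAt Γ (q u) u := fun u => (hqc.integral_hasStrictDerivAt 0 u).hasDerivAt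
  have hΓ0 : Γ 0 = 0 := intervalIntegral.integral_same
  have hΓb : ∀ u ∈ Icc (0 : ℝ) 1, ‖Γ u‖ ≤ Q * ‖v‖ := fun u hu => by
    have h1 := intervalIntegral.norm_integral_le_of_norm_le_const (a := 0) (b := u)
      (f := q) (C := Q * ‖v‖) fun s _ => hqQ s
    rw [sub_zero, abs_of_nonneg hu.1] at h1
    exact h1.trans (mul_le_of_le_one_right (by positivity) hu.2)
  set f : ℝ → EuclideanSpace ℝ (Fin d) := fun t => Γ (φ t) with hf
  set f' : ℝ → EuclideanSpace ℝ (Fin d) := fun t => deriv φ t • q (φ t) with hf'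
  have hfd : ∀ t, HasDerivAt f (f' t) t := fun t =>
    (hΓd (φ t)).scomp t (hφ t).hasDerivAt
  set f'' : ℝ → EuclideanSpace ℝ (Fin d) := fun t =>
    deriv φ t • (deriv φ t • q' (φ t)) + deriv (deriv φ) t • q (φ t) with hf''
  have hfd' : ∀ t, HasDerivAt f' (f'' t) t := fun t =>
    (hφ' t).hasDerivAt.smul ((hq (φ t)).scomp t (hφ t).hasDerivAt)
  have hA : 0 ≤ D * ‖v‖ := by positivity
  have hQv : 0 ≤ Q * ‖v‖ := by positivity
  have hfb : ∀ t, ‖f t‖ ≤ D * ‖v‖ := fun t => by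
    have h1 := hΓb _ (hφI t)
    have h2 : 0 ≤ Q * ‖v‖ * (K + K ^ 2) := by positivity
    rw [hD]
    linarith
  have hfb' : ∀ t, ‖f' t‖ ≤ D * ‖v‖ := fun t => by
    rw [hf', norm_smul, Real.norm_eq_abs]
    have h1 := mul_le_mul (hφK t) (hqQ (φ t)) (norm_nonneg _) hK0
    have h2 : 0 ≤ Q * ‖v‖ * (1 + K ^ 2) := by positivity
    rw [hD]
    linarith
  have hfb'' : ∀ t, ‖f'' t‖ ≤ D * ‖v‖ := fun t => by
    refine (norm_add_le _ _).trans ?_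
    rw [norm_smul, norm_smul, norm_smul, Real.norm_eq_abs, Real.norm_eq_abs]
    have h1 := mul_le_mul (hφK t) (hqQ' (φ t)) (norm_nonneg _) hK0
    have h2 := mul_le_mul (hφK t) h1 (by positivity) hK0
    have h3 := mul_le_mul (hφK' t) (hqQ (φ t)) (norm_nonneg _) hK0
    rw [hD]
    linarith
  have hfc : Continuous f := continuous_iff_continuousAt.2 fun t => (hfd t).continuousAt
  have hproj : ∀ {F F' : ℝ → EuclideanSpace ℝ (Fin d)}, (∀ t, HasDerivAt F (F' t) t) →
      ∀ i t, HasDerivAt (fun t => F t i) (F' t i) t := fun hF i t =>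
    (EuclideanSpace.proj (𝕜 := ℝ) i).hasFDerivAt.comp_hasDerivAt t (hF t)
  have hder1 : ∀ i, deriv (fun t => f t i) = fun t => f' t i := fun i =>
    funext fun t => (hproj hfd i t).deriv
  have hder2 : ∀ i, deriv (fun t => f' t i) = fun t => f'' t i := fun i =>
    funext fun t => (hproj hfd' i t).deriv
  have hcoord : ∀ (w : EuclideanSpace ℝ (Fin d)) i, |w i| ≤ ‖w‖ := fun w i => by
    rw [← Real.norm_eq_abs]; exact PiLp.norm_apply_le w i
  have hbump : ∀ i, IsBumpPath (D * ‖v‖) fun t => f t i := fun i =>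
    { differentiable := fun t => (hproj hfd i t).differentiableAt
      differentiable_deriv := by
        rw [hder1]; exact fun t => (hproj hfd' i t).differentiableAt
      eq_zero := fun t ht => by simp [hf, hφs t ht, hΓ0]
      bound := fun t => (hcoord _ i).trans (hfb t)
      bound_deriv := fun t => by rw [hder1]; exact (hcoord _ i).trans (hfb' t)
      bound_deriv2 := fun t => by rw [hder1, hder2]; exact (hcoord _ i).trans (hfb'' t) }
  set h : C(I, EuclideanSpace ℝ (Fin d)) := ⟨fun t => f t, hfc.comp continuous_subtype_val⟩ with hh
  set Y : ℝ → EuclideanSpace ℝ (Fin N) := fun t => x + φ t • v with hY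
  have hYd : ∀ t, HasDerivAt Y (deriv φ t • v) t := fun t =>
    ((hφ t).hasDerivAt.smul_const v).const_add x
  have hYc : Continuous Y := continuous_iff_continuousAt.2 fun t => (hYd t).continuousAt
  set X : C(I, EuclideanSpace ℝ (Fin N)) := ⟨fun t => Y t, hYc.comp continuous_subtype_val⟩ with hX
  have hf0 : f 0 = 0 := by simp only [hf, hφ0, hΓ0]
  obtain ⟨Z, hZ, hZn⟩ := HC P B hB (D * ‖v‖) h (fun i t => f t i) hbump
    (fun i => by simp [hf0]) (fun t i => rfl) hA
  have hsol : IsYoungSolution V h (Y 0) X :=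
    isYoungSolution_of_hasDerivAt hL0.le
      (fun y z => convex_univ.norm_image_sub_le_of_norm_fderiv_le (fun w _ => hdiff w)
        (fun w _ => hL w) (mem_univ z) (mem_univ y))
      hfd hYd (fun t => by rw [hf', map_smul]; congr 1; exact (hGq (φ t)).symm) hfb'
      (R' := K * ‖v‖) (fun t => by
        rw [norm_smul, Real.norm_eq_abs]
        exact mul_le_mul_of_nonneg_right (hφK t) hv0)
      (fun _ => rfl) (fun _ => rfl)
  have hY0 : Y 0 = x := by simp [hY, hφ0]
  rw [hY0] at hsol
  refine ⟨h, ⟨⟨?_, Z, hZ⟩, X, hsol, ?_⟩, ?_⟩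
  · exact hf0
  · change Y 1 = y
    simp [hY, hφ1, hv]
  · rw [hZ.cmNorm_eq]
    linarith

theorem exists_norm_sub_le_cmNorm {H : ℝ} (hH : 0 < H) (hV : IsCbInfty V) :
    ∃ C > 0, ∀ {Ω : Type*} [MeasurableSpace Ω] (P : Measure Ω)
      (B : I → Ω → EuclideanSpace ℝ (Fin d)), IsFractionalBrownianMotion P H B →
      ∀ x y : EuclideanSpace ℝ (Fin N), ‖x - y‖ ≤ 1 → ∀ h ∈ joiningPaths V P B x y,
        ‖x - y‖ ≤ C * cmNorm P B h := by
  obtain ⟨M, hM0, L, hL0, hM, hdiff, hL⟩ := hV.exists_bounds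
  set γ := pathExponent H with hγdef
  have hγ : 1 / 2 < γ := half_lt_pathExponent hH
  have hκ := sewingGap_pos hγ
  have hd0 : (0 : ℝ) ≤ d := d.cast_nonneg
  set W : ℝ := (d + 2) * (d + 1) ^ γ with hW
  have hW0 : 0 < W := by positivity
  refine ⟨3 * M * W + L * W / sewingGap γ, by positivity, fun {Ω} _ P B hB x y hxy h hh => ?_⟩
  obtain ⟨⟨-, Z, hZ⟩, X, hsol, hX1⟩ := hh
  rw [hZ.cmNorm_eq]
  have hZ0 := norm_nonneg Z
  obtain ⟨ω, hω, hω1, hinc⟩ := exists_isControl hH (b := fun t i => hB.evalLp t i)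
    (fun s t i => by rw [hB.inner_evalLp_evalLp, if_pos rfl]) (Z := Z) (h := h)
    (fun t i => by rw [hZ.2, hB.inner_evalLp])
  have hω0 := hω.nonneg 0 1 zero_le_one
  have hωW : (d + 2) * ‖Z‖ * ω 0 1 ^ γ ≤ W * ‖Z‖ := by
    have : ω 0 1 ^ γ ≤ (d + 1 : ℝ) ^ γ := Real.rpow_le_rpow hω0 hω1 (by linarith)
    calc _ ≤ (d + 2) * ‖Z‖ * (d + 1 : ℝ) ^ γ := by gcongr
      _ = _ := by rw [hW]; ring
  -- either the a priori estimate applies, or the norm of `h` is bounded below by a constant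
  rcases le_or_gt (L * (W * ‖Z‖)) (sewingGap γ) with hsmall | hlarge
  · have h1 := hsol.norm_sub_le hL0.le
      (fun y z => convex_univ.norm_image_sub_le_of_norm_fderiv_le (fun w _ => hdiff w)
        (fun w _ => hL w) (mem_univ z) (mem_univ y)) hM0.le hM hω hγ (by positivity) hinc
      (by
        refine le_trans ?_ hsmall
        rw [mul_assoc]
        gcongr)
    rw [hX1, norm_sub_rev] at h1
    have h2 : M * ((d + 2) * ‖Z‖) * ω 0 1 ^ γ ≤ M * (W * ‖Z‖) := by
      rw [mul_assoc]
      gcongr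
    have h3 : 0 ≤ L * W / sewingGap γ * ‖Z‖ := by positivity
    linarith
  · have h1 : 1 ≤ L * W / sewingGap γ * ‖Z‖ := by
      rw [div_mul_eq_mul_div, le_div_iff₀ hκ]
      linarith
    have h2 : 0 ≤ 3 * M * W * ‖Z‖ := by positivity
    linarith

end Bounds

end FBM

theorem theorem3p3 {N d : ℕ} (H : ℝ) (hH : 1 / 4 < H) (hH' : H < 1)
    (V : Fin d → EuclideanSpace ℝ (Fin N) → EuclideanSpace ℝ (Fin N))
    (hV : FBM.IsCbInfty V) (hell : FBM.IsUniformlyElliptic V) :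
    ∃ C₁ > 0, ∃ C₂ > 0,
      ∀ {Ω : Type*} [MeasurableSpace Ω] (P : Measure Ω) [IsProbabilityMeasure P]
        (B : unitInterval → Ω → EuclideanSpace ℝ (Fin d)),
        FBM.IsFractionalBrownianMotion P H B →
        ∀ x y : EuclideanSpace ℝ (Fin N), ‖x - y‖ ≤ 1 →
          ENNReal.ofReal (C₁ * ‖x - y‖) ≤ FBM.controlDist V P B x y ∧
          FBM.controlDist V P B x y ≤ ENNReal.ofReal (C₂ * ‖x - y‖) := by
  have hH0 : 0 < H := by linarith
  obtain ⟨C, hC, lower⟩ := FBM.exists_norm_sub_le_cmNorm hH0 hV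
  obtain ⟨C₂, hC₂, upper⟩ := FBM.exists_joining_path hH0 hH' hV hell
  refine ⟨C⁻¹, by positivity, C₂, hC₂, fun {Ω} _ P _ B hB x y hxy => ⟨?_, ?_⟩⟩
  · refine le_iInf₂ fun h hh => ENNReal.ofReal_le_ofReal ?_
    rw [inv_mul_le_iff₀ hC]
    exact lower P B hB x y hxy h hh
  · obtain ⟨h, hh, hn⟩ := upper P B hB x y hxy
    exact (iInf₂_le h hh).trans (ENNReal.ofReal_le_ofReal hn)
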